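/- Let $V$ be an infinite countable set and $(b,c)$ a connected weighted graph over $V$: $b:V\times V\to[0,\infty)$ is symmetric with $b(x,x)=0$ and $\sum_{y} b(x,y)<\infty$ for all $x$, $c:V\to[0,\infty)$, and any two vertices are joined by a finite path $x_0,\dots,x_n$ with $b(x_j,x_{j+1})>0$. For $u:V\to\mathbb R$ let $$\widetilde Q(u)=\tfrac12\sum_{x,y\in V}b(x,y)(u(x)-u(y))^2+\sum_{x\in V}c(x)u(x)^2\in[0,\infty],$$ $\widetilde D=\{u:\widetilde Q(u)<\infty\}$, and let $\widetilde Q(u,v)$ denote the corresponding bilinear form on $\widetilde D$. Let $m:V\to(0,\infty)$ be a measure of full support. Let $Q$ be a Dirichlet form on $\ell^2(V,m)$ associated with $(b,c)$, i.e. a densely defined, closed, symmetric, non-negative bilinear form on $\ell^2(V,m)$ that is compatible with all normal contractions, is a restriction of $\widetilde Q$, and satisfies $\overline{C_c(V)}^{\|\cdot\|_Q}\subseteq D(Q)\subseteq \widetilde D\cap\ell^2(V,m)$, where $C_c(V)$ are the finitely supported functions and the closure is taken in $\widetilde D\cap\ell^2(V,m)$ for the norm $\|u\|_Q=(\widetilde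 Q(u)+\|u\|_2^2)^{1/2}$. Let $L$ be the non-negative self-adjoint operator on $\ell^2(V,m)$ associated with $Q$, let $e^{-tL}$ be its semigroup, and put $G(x,y)=\int_0^\infty e^{-tL}\delta_x(y)\,dt\in[0,\infty]$. The semigroup is called recurrent if $G(x,y)=\infty$ for all $x,y\in V$, and transient if $G(x,y)<\infty$ for all $x,y\in V$. The extended Dirichlet space $D(Q)_e$ is the space of all $u:V\to\mathbb R$ that are pointwise limits of $Q$-Cauchy sequences in $D(Q)$; it is contained in $\widetilde D$, and $Q$ is extended to it by $Q(u,v)=\widetilde Q(u,v)$. Write $Q(u)=Q(u,u)$. (a) The following are equivalent: (i) The semigroup $e^{-tL}$ is recurrent. (ii) There is a sequence $(u_n)$ in $D(Q)$ with $u_n\to 1$ pointwise and $Q(u_n)\to 0$. (iii) $1\in D(Q)_e$ and $Q(1)=0$. (b) The following are equivalent: (i) The semigroup $e^{-tL}$ is transient. (ii) $u=0$ for every $u\in D(Q)_e$ with $Q(u)=0$. (iii) $(D(Q)_e,Q)$ is a real Hilbert space. -/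

import Mathlib

open Filter Topology
open scoped ENNReal

noncomputable section

/-- A weighted graph `(b, c)` over the vertex set `V`. -/
structure WeightedGraph (V : Type*) where
  /-- edge weights -/
  b : V → V → ℝ
  /-- the potential (killing term) -/
  c : V → ℝ
  b_nonneg : ∀ x y, 0 ≤ b x y
  b_self : ∀ x, b x x = 0
  b_symm : ∀ x y, b x y = b y x
  b_summable : ∀ x, Summable (b x)
  c_nonneg : ∀ x, 0 ≤ c x

namespace WeightedGraph

variable {V : Type*} (G : WeightedGraph V)

/-- Any two vertices are joined by a finite path of edges of positive weight. -/
def Connected : Prop :=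
  ∀ x y : V, Relation.ReflTransGen (fun v w => 0 < G.b v w) x y

/-- The quadratic form `Q̃(u) ∈ [0, ∞]`, for an arbitrary real function `u` on `V`. -/
def energy (u : V → ℝ) : ℝ≥0∞ :=
  (1 / 2) * ∑' p : V × V, ENNReal.ofReal (G.b p.1 p.2 * (u p.1 - u p.2) ^ 2)
    + ∑' x, ENNReal.ofReal (G.c x * u x ^ 2)

/-- The bilinear form `Q̃(u, v)`; its sums converge absolutely if `u` and `v` have
finite energy, and then `Q̃(u, u)` is the energy of `u`. -/
def energyForm (u v : V → ℝ) : ℝ :=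
  (1 / 2) * ∑' p : V × V, G.b p.1 p.2 * (u p.1 - u p.2) * (v p.1 - v p.2)
    + ∑' x, G.c x * u x * v x

end WeightedGraph

/-- A measure of full support on the discrete set `V`, given by its strictly positive point
masses. -/
structure VertexMeasure (V : Type*) where
  /-- the mass of a point -/
  mass : V → ℝ
  mass_pos : ∀ x, 0 < mass x

/-- The functions `u` with `∑ u(x)² m(x) < ∞`. -/
def ell2Submodule {V : Type*} (m : VertexMeasure V) : Submodule ℝ (V → ℝ) where
  carrier := {u | Summable fun x => u x ^ 2 * m.mass x}
  zero_mem' := by simp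
  add_mem' := by
    intro u v hu hv
    refine Summable.of_nonneg_of_le (fun x => ?_) (fun x => ?_) ((hu.mul_left 2).add (hv.mul_left 2))
    · exact mul_nonneg (sq_nonneg _) (m.mass_pos x).le
    · have := m.mass_pos x
      simp only [Pi.add_apply]
      nlinarith [mul_nonneg (sq_nonneg (u x - v x)) this.le]
  smul_mem' := by
    intro r u hu
    refine (hu.mul_left (r ^ 2)).congr fun x => ?_
    simp only [Pi.smul_apply, smul_eq_mul]
    ring

/-- The space `ℓ²(V, m)`. It is a separate type so that it carries the `ℓ²`-norm topology and
not the topology of pointwise convergence. -/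
def Ell2 {V : Type*} (m : VertexMeasure V) : Type _ := ↥(ell2Submodule m)

namespace Ell2

variable {V : Type*} {m : VertexMeasure V}

@[reducible] def addCommGroupAux : AddCommGroup (Ell2 m) :=
  inferInstanceAs (AddCommGroup ↥(ell2Submodule m))

attribute [local instance] addCommGroupAux

@[reducible] def moduleAux : Module ℝ (Ell2 m) := inferInstanceAs (Module ℝ ↥(ell2Submodule m))

attribute [local instance] moduleAux

instance : CoeFun (Ell2 m) (fun _ => V → ℝ) := ⟨fun u => u.1⟩

theorem summable_mul (u v : Ell2 m) : Summable fun x => u x * v x * m.mass x := by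
  refine Summable.of_norm_bounded (u.2.add v.2) fun x => ?_
  have hm := m.mass_pos x
  rw [Real.norm_eq_abs, abs_mul, abs_of_pos hm, ← add_mul]
  refine mul_le_mul_of_nonneg_right ?_ hm.le
  rw [abs_le]
  constructor <;> nlinarith [sq_nonneg (u.1 x - v.1 x), sq_nonneg (u.1 x + v.1 x)]

/-- The inner product `⟨u, v⟩ = ∑ u(x) v(x) m(x)`. -/
@[reducible] def innerCore : InnerProductSpace.Core ℝ (Ell2 m) where
  inner u v := ∑' x, u x * v x * m.mass x
  conj_inner_symm u v := by
    simp only [conj_trivial]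
    exact tsum_congr fun x => by ring
  re_inner_nonneg u := by
    refine tsum_nonneg fun x => ?_
    exact mul_nonneg (mul_self_nonneg _) (m.mass_pos x).le
  add_left u v w := by
    rw [← (summable_mul u w).tsum_add (summable_mul v w)]
    exact tsum_congr fun x => by
      change (u x + v x) * w x * m.mass x = _
      ring
  smul_left u v r := by
    simp only [conj_trivial]
    rw [← tsum_mul_left]
    exact tsum_congr fun x => by
      change (r * u x) * v x * m.mass x = _
      ring
  definite u hu := by
    have h0 := (hasSum_zero_iff_of_nonneg
      (fun x => mul_nonneg (mul_self_nonneg (u x)) (m.mass_pos x).le)).1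
      (hu ▸ (summable_mul u u).hasSum)
    refine Subtype.ext (funext fun x => ?_)
    have hx : u x * u x * m.mass x = 0 := congrFun h0 x
    exact mul_self_eq_zero.1 ((mul_eq_zero.1 hx).resolve_right (m.mass_pos x).ne')

instance : NormedAddCommGroup (Ell2 m) := innerCore.toNormedAddCommGroup

instance : InnerProductSpace ℝ (Ell2 m) := InnerProductSpace.ofCore innerCore.toCore

/-- The function `δ_x` as an element of `ℓ²(V, m)`. -/
def delta (m : VertexMeasure V) (x : V) : Ell2 m :=
  ⟨Set.indicator {x} 1, by
    refine summable_of_hasFiniteSupport ((Set.finite_singleton x).subset fun y hy => ?_)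
    by_contra hne
    exact hy (by simp [Set.indicator_of_notMem hne])⟩

end Ell2

/-- `(W, B)` is a real Hilbert space: `B` is an inner product on the real vector space `W`, and
`W` is complete for the norm of `B`. -/
def IsHilbertSpaceWith (W : Type*) [AddCommGroup W] [Module ℝ W] (B : W → W → ℝ) : Prop :=
  ∃ core : InnerProductSpace.Core ℝ W, (∀ u v, core.inner u v = B u v) ∧
    @CompleteSpace W core.toNormedAddCommGroup.toMetricSpace.toUniformSpace

/-- A Dirichlet form on `ℓ²(V, m)`. -/
structure DirichletForm {V : Type*} (m : VertexMeasure V) where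
  /-- the form domain `D(Q)` -/
  domain : Submodule ℝ (Ell2 m)
  dense_domain : Dense (domain : Set (Ell2 m))
  /-- the form `Q` on its domain -/
  form : domain →ₗ[ℝ] domain →ₗ[ℝ] ℝ
  nonneg : ∀ u, 0 ≤ form u u
  symm : ∀ u v, form u v = form v u
  closed : IsHilbertSpaceWith domain fun u v => form u v + inner ℝ (u : Ell2 m) (v : Ell2 m)
  markov : ∀ C : ℝ → ℝ, C 0 = 0 → (∀ s t, |C s - C t| ≤ |s - t|) →
    ∀ u : domain, ∃ v : domain, (∀ x, v.1 x = C (u.1 x)) ∧ form v v ≤ form u u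

namespace WeightedGraph

variable {V : Type*} (G : WeightedGraph V) (m : VertexMeasure V)

/-- The domain of the Neumann form: all `ℓ²`-functions of finite energy. -/
def neumannDomain : Set (Ell2 m) := {u | G.energy u < ∞}

/-- The domain of the regular Dirichlet form of the graph: the closure, within the `ℓ²`-functions
of finite energy, of the finitely supported functions for the form norm
`(Q̃(u) + ‖u‖²)^(1/2)`. -/
def regularDomain : Set (Ell2 m) :=
  {u | u ∈ G.neumannDomain m ∧ ∃ φ : ℕ → Ell2 m, (∀ n, (Function.support (φ n)).Finite) ∧
    Tendsto (fun n => G.energyForm (u - φ n) (u - φ n) + ‖u - φ n‖ ^ 2) atTop (𝓝 0)}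

end WeightedGraph

namespace DirichletForm

variable {V : Type*} {m : VertexMeasure V} (Q : DirichletForm m)

/-- `Q` is associated to the graph `G`: it is a restriction of the form `Q̃` of `G`, with a domain
between those of the regular Dirichlet form and of the Neumann form. -/
structure IsAssociated (G : WeightedGraph V) : Prop where
  form_eq : ∀ u v : Q.domain, Q.form u v = G.energyForm u.1 v.1
  regular_subset : G.regularDomain m ⊆ Q.domain
  subset_neumann : (Q.domain : Set (Ell2 m)) ⊆ G.neumannDomain m

/-- `u ∈ D(L)` and `L u = w`, where `L` is the operator associated with `Q`. -/
def OperatorGraph (u w : Ell2 m) : Prop :=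
  ∃ hu : u ∈ Q.domain, ∀ v : Q.domain, Q.form ⟨u, hu⟩ v = inner ℝ w (v : Ell2 m)

end DirichletForm

theorem IsHilbertSpaceWith.exists_forall_eq_inner {W H : Type*} [AddCommGroup W] [Module ℝ W]
    [NormedAddCommGroup H] [InnerProductSpace ℝ H] (ι : W →ₗ[ℝ] H) (a : W →ₗ[ℝ] W →ₗ[ℝ] ℝ)
    (ha : ∀ u, 0 ≤ a u u)
    (hW : IsHilbertSpaceWith W fun u v => a u v + inner ℝ (ι u) (ι v))
    {α : ℝ} (hα : 0 < α) (f : H) :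
    ∃ u, ∀ v, a u v + α * inner ℝ (ι u) (ι v) = inner ℝ f (ι v) := by
  obtain ⟨core, hB, hc⟩ := hW
  let _ : NormedAddCommGroup W := core.toNormedAddCommGroup
  let _ : InnerProductSpace ℝ W := .ofCore core.toCore
  have _ : CompleteSpace W := hc
  have hin : ∀ u v : W, inner ℝ u v = a u v + inner ℝ (ι u) (ι v) := hB
  have hn : ∀ u : W, ‖u‖ ^ 2 = a u u + ‖ι u‖ ^ 2 := fun u => by
    rw [← real_inner_self_eq_norm_sq, hin, real_inner_self_eq_norm_sq]
  have hι : ∀ u : W, ‖ι u‖ ≤ 1 * ‖u‖ := fun u => by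
    rw [one_mul]
    exact le_of_sq_le_sq (by linarith [hn u, ha u]) (norm_nonneg _)
  let ιc : W →L[ℝ] H := ι.mkContinuous 1 hι
  let B : W →L[ℝ] W →L[ℝ] ℝ := innerSL ℝ + (α - 1) • (innerSL ℝ).bilinearComp ιc ιc
  have hBuv : ∀ u v, B u v = a u v + α * inner ℝ (ι u) (ι v) := fun u v => by
    have : B u v = inner ℝ u v + (α - 1) * inner ℝ (ι u) (ι v) := rfl
    rw [this, hin]; ring
  have hco : IsCoercive B := by
    refine ⟨min 1 α, lt_min one_pos hα, fun u => ?_⟩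
    rw [hBuv, real_inner_self_eq_norm_sq, mul_assoc, ← sq, hn, mul_add]
    exact add_le_add (by nlinarith [ha u, min_le_left 1 α])
      (mul_le_mul_of_nonneg_right (min_le_right 1 α) (sq_nonneg _))
  let g : W := (InnerProductSpace.toDual ℝ W).symm ((innerSL ℝ f).comp ιc)
  refine ⟨hco.continuousLinearEquivOfBilin.symm g, fun v => ?_⟩
  rw [← hBuv, ← hco.continuousLinearEquivOfBilin_apply, ContinuousLinearEquiv.apply_symm_apply]
  exact InnerProductSpace.toDual_symm_apply

namespace DirichletForm

variable {V : Type*} {m : VertexMeasure V} (Q : DirichletForm m)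

/-- For `α > 0` the operator `L + α : D(L) → ℓ²(V, m)` has a bounded inverse. -/
theorem exists_resolvent {α : ℝ} (hα : 0 < α) :
    ∃ R : Ell2 m →L[ℝ] Ell2 m, ∀ f u, R f = u ↔ Q.OperatorGraph u (f - α • u) := by
  have key : ∀ f : Ell2 m, ∃ u : Q.domain, ∀ v : Q.domain,
      Q.form u v + α * inner ℝ (u : Ell2 m) (v : Ell2 m) = inner ℝ f (v : Ell2 m) := fun f =>
    Q.closed.exists_forall_eq_inner Q.domain.subtype Q.form Q.nonneg hα f
  have uniq : ∀ u : Q.domain, (∀ v : Q.domain,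
      Q.form u v + α * inner ℝ (u : Ell2 m) (v : Ell2 m) = 0) → u = 0 := fun u hu => by
    have h1 := hu u
    rw [real_inner_self_eq_norm_sq] at h1
    have h2 : ‖(u : Ell2 m)‖ ^ 2 = 0 := by
      have := Q.nonneg u
      have h3 : α * ‖(u : Ell2 m)‖ ^ 2 ≤ 0 := by linarith
      exact le_antisymm (nonpos_of_mul_nonpos_right h3 hα) (sq_nonneg _)
    exact Subtype.ext (by simpa using h2)
  choose r hr using key
  let R : Ell2 m →ₗ[ℝ] Q.domain :=
    { toFun := r
      map_add' := fun f g => by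
        rw [← sub_eq_zero]
        refine uniq _ fun v => ?_
        have h1 := hr (f + g) v
        have h2 := hr f v
        have h3 := hr g v
        rw [inner_add_left] at h1
        simp only [map_sub, map_add, LinearMap.sub_apply, LinearMap.add_apply,
          Submodule.coe_sub, Submodule.coe_add, inner_sub_left, inner_add_left]
        linarith
      map_smul' := fun s f => by
        rw [← sub_eq_zero]
        refine uniq _ fun v => ?_
        have h1 := hr (s • f) v
        have h2 := hr f v
        rw [real_inner_smul_left] at h1
        simp only [RingHom.id_apply, map_sub, map_smul, LinearMap.sub_apply, LinearMap.smul_apply,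
          Submodule.coe_sub, Submodule.coe_smul, inner_sub_left, real_inner_smul_left, smul_eq_mul]
        linear_combination h1 - s * h2 }
  have hbound : ∀ f : Ell2 m, ‖(Q.domain.subtype.comp R) f‖ ≤ α⁻¹ * ‖f‖ := fun f => by
    change ‖(r f : Ell2 m)‖ ≤ _
    have h1 := hr f (r f)
    rw [real_inner_self_eq_norm_sq] at h1
    have h2 := real_inner_le_norm f (r f : Ell2 m)
    have h3 := Q.nonneg (r f)
    rw [inv_mul_eq_div, le_div_iff₀ hα]
    rcases (norm_nonneg (r f : Ell2 m)).eq_or_lt with h0 | h0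
    · rw [← h0, zero_mul]; exact norm_nonneg _
    · nlinarith
  refine ⟨(Q.domain.subtype.comp R).mkContinuous α⁻¹ hbound, fun f u => ⟨?_, ?_⟩⟩
  · rintro rfl
    refine ⟨(r f).2, fun v => ?_⟩
    have h1 := hr f v
    change Q.form (r f) v = inner ℝ (f - α • (r f : Ell2 m)) (v : Ell2 m)
    rw [inner_sub_left, real_inner_smul_left]
    linarith
  · rintro ⟨hu, h⟩
    have : r f = ⟨u, hu⟩ := by
      rw [← sub_eq_zero]
      refine uniq _ fun v => ?_
      have h1 := hr f v
      have h2 := h v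
      rw [inner_sub_left, real_inner_smul_left] at h2
      simp only [map_sub, LinearMap.sub_apply, Submodule.coe_sub, inner_sub_left]
      linarith
    exact congrArg Subtype.val this

/-- The resolvent `(L + α)⁻¹` for `α > 0`: the bounded inverse of `L + α : D(L) → ℓ²(V, m)`. -/
def resolvent (α : ℝ) : Ell2 m →L[ℝ] Ell2 m :=
  if hα : 0 < α then (Q.exists_resolvent hα).choose else 0

/-- The semigroup `e^{-tL}`, as the strong limit, for `α → ∞`, of the operators `e^{-t L_α}`,
where `L_α = α L (L + α)⁻¹ = α (1 - α (L + α)⁻¹)` is the bounded Yosida approximation of `L`. -/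
def semigroup (t : ℝ) (f : Ell2 m) : Ell2 m :=
  limUnder atTop fun α : ℝ =>
    NormedSpace.exp (-(t * α) • (ContinuousLinearMap.id ℝ (Ell2 m) - α • Q.resolvent α)) f

/-- `G(x, y) = ∫₀^∞ e^{-tL} δ_x (y) dt ∈ [0, ∞]`. -/
def green (x y : V) : ℝ≥0∞ :=
  ∫⁻ t in Set.Ioi (0 : ℝ), ENNReal.ofReal (Q.semigroup t (Ell2.delta m x) y)

/-- The semigroup `e^{-tL}` is transient. -/
def IsTransient : Prop := ∀ x y, Q.green x y < ∞

/-- The semigroup `e^{-tL}` is recurrent. -/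
def IsRecurrent : Prop := ∀ x y, Q.green x y = ∞

/-- The sequence `u` in `D(Q)` is Cauchy for the seminorm `Q(·)^(1/2)`. -/
def IsCauchy (u : ℕ → Q.domain) : Prop :=
  ∀ ε > 0, ∃ N, ∀ k ≥ N, ∀ l ≥ N, √(Q.form (u k - u l) (u k - u l)) < ε

theorem sqrt_form_add_le (u v : Q.domain) :
    √(Q.form (u + v) (u + v)) ≤ √(Q.form u u) + √(Q.form v v) := by
  have hcs : Q.form u v * Q.form v u ≤ Q.form u u * Q.form v v :=
    LinearMap.BilinForm.apply_mul_apply_le_of_forall_zero_le Q.form Q.nonneg u v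
  rw [Q.symm v u] at hcs
  have hle : Q.form u v ≤ √(Q.form u u) * √(Q.form v v) := by
    rw [← Real.sqrt_mul (Q.nonneg u)]
    exact Real.le_sqrt_of_sq_le (by rw [sq]; exact hcs)
  refine Real.sqrt_le_iff.2 ⟨by positivity, ?_⟩
  simp only [map_add, LinearMap.add_apply]
  rw [Q.symm v u]
  nlinarith [Real.sq_sqrt (Q.nonneg u), Real.sq_sqrt (Q.nonneg v)]

/-- The extended Dirichlet space `D(Q)_e`: all functions that are pointwise limits of
`Q`-Cauchy sequences in `D(Q)`. -/
def extendedSpace : Submodule ℝ (V → ℝ) where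
  carrier := {u | ∃ w : ℕ → Q.domain, Q.IsCauchy w ∧
    ∀ x, Tendsto (fun n => (w n).1 x) atTop (𝓝 (u x))}
  zero_mem' := ⟨fun _ => 0, fun ε hε => ⟨0, fun k _ l _ => by simpa using hε⟩,
    fun x => tendsto_const_nhds⟩
  add_mem' := by
    rintro u v ⟨w, hw, hu⟩ ⟨w', hw', hv⟩
    refine ⟨fun n => w n + w' n, fun ε hε => ?_, fun x => (hu x).add (hv x)⟩
    obtain ⟨N, hN⟩ := hw (ε / 2) (half_pos hε)
    obtain ⟨N', hN'⟩ := hw' (ε / 2) (half_pos hε)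
    refine ⟨max N N', fun k hk l hl => ?_⟩
    have h1 := hN k (le_trans (le_max_left _ _) hk) l (le_trans (le_max_left _ _) hl)
    have h2 := hN' k (le_trans (le_max_right _ _) hk) l (le_trans (le_max_right _ _) hl)
    have h3 := Q.sqrt_form_add_le (w k - w l) (w' k - w' l)
    rw [add_sub_add_comm]
    linarith
  smul_mem' := by
    rintro s u ⟨w, hw, hu⟩
    refine ⟨fun n => s • w n, fun ε hε => ?_, fun x => (hu x).const_mul s⟩
    obtain ⟨N, hN⟩ := hw (ε / (|s| + 1)) (by positivity)
    refine ⟨N, fun k hk l hl => ?_⟩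
    have h1 := hN k hk l hl
    rw [lt_div_iff₀ (by positivity)] at h1
    rw [← smul_sub]
    simp only [map_smul, LinearMap.smul_apply, smul_eq_mul]
    rw [← mul_assoc, Real.sqrt_mul (mul_self_nonneg s), Real.sqrt_mul_self_eq_abs]
    nlinarith [Real.sqrt_nonneg (Q.form (w k - w l) (w k - w l))]

end DirichletForm

end

noncomputable section

/-! ### The Hilbert space `ℓ²(V, m)` and its point evaluations. -/

namespace Ell2

variable {V : Type*} {m : VertexMeasure V}

/-! Everything is decided by one question: is evaluation `v ↦ v(x)` on `D(Q)` bounded for the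
seminorm `Q^(1/2)` (`IsBoundedAt`)? On a connected graph the differences `v(x) - v(y)` always are,
by summing along a path, so the answer does not depend on `x`.

The link with the Green function is the resolvent kernel `g = (L + l)⁻¹ δ_x`. It represents `v ↦
v(x) m(x)` for the form `Q + l⟨·,·⟩`, and, being the Laplace transform of the positive semigroup, it
increases to `G(x, ·)` as `l ↓ 0`. Cauchy–Schwarz gives `v(x)² m(x) ≤ g(x) (Q(v) + l‖v‖²)`, so `G(x,
x) < ∞` bounds evaluation at `x`; conversely, bounded evaluations bound `g(y)` uniformly in `l`.
Comparing `g(x)` with `g(y)` shows that unbounded evaluation forces `G = ∞` everywhere. Hence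
transience is boundedness (`isTransient_iff`) and recurrence is its negation (`isRecurrent_iff`).

If evaluation at `x` is unbounded, functions normalised by `v(x) = 1` with energy tending to `0`
converge pointwise to `1`, and lower semicontinuity of the energy puts `1` into the extended space
with `Q(1) = 0`. If it is bounded, the bound passes to the extended space: null elements vanish
there, and energy-Cauchy sequences converge pointwise, which yields completeness. -/

theorem inner_def (u v : Ell2 m) : inner ℝ u v = ∑' x, u x * v x * m.mass x := rfl

theorem norm_sq_def (u : Ell2 m) : ‖u‖ ^ 2 = ∑' x, u x * u x * m.mass x := by
  rw [← real_inner_self_eq_norm_sq, inner_def]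

/-- The isometric linear map `u ↦ √m u` onto the unweighted `ℓ²`-space. -/
def toLp (m : VertexMeasure V) : Ell2 m →ₗ[ℝ] lp (fun _ : V => ℝ) 2 where
  toFun u := ⟨fun x => √(m.mass x) * u x, by
    refine (memℓp_gen_iff (by norm_num)).2 (u.2.congr fun x => ?_)
    simp only [ENNReal.toReal_ofNat, Real.rpow_ofNat, Real.norm_eq_abs, sq_abs, mul_pow]
    rw [Real.sq_sqrt (m.mass_pos x).le, mul_comm]⟩
  map_add' u v := by
    ext x
    exact mul_add _ _ _
  map_smul' r u := by
    ext x
    exact mul_left_comm _ _ _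

theorem toLp_apply (u : Ell2 m) (x : V) : toLp m u x = √(m.mass x) * u x := rfl

theorem norm_toLp (u : Ell2 m) : ‖toLp m u‖ = ‖u‖ := by
  refine (sq_eq_sq₀ (norm_nonneg _) (norm_nonneg _)).1 ?_
  rw [norm_sq_def, ← real_inner_self_eq_norm_sq, lp.inner_eq_tsum]
  refine tsum_congr fun x => ?_
  rw [toLp_apply, real_inner_self_eq_norm_sq, Real.norm_eq_abs, sq_abs, mul_pow,
    Real.sq_sqrt (m.mass_pos x).le]
  ring

theorem toLp_surjective : Function.Surjective (toLp m) := fun f => by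
  have hf := (memℓp_gen_iff (by norm_num)).1 f.2
  have hs : ∀ x, √(m.mass x) ≠ 0 := fun x => (Real.sqrt_pos.2 (m.mass_pos x)).ne'
  refine ⟨⟨fun x => (√(m.mass x))⁻¹ * f x, hf.congr fun x => ?_⟩, ?_⟩
  · simp only [ENNReal.toReal_ofNat, Real.rpow_ofNat, Real.norm_eq_abs, sq_abs, mul_pow, inv_pow]
    rw [Real.sq_sqrt (m.mass_pos x).le, mul_right_comm, inv_mul_cancel₀ (m.mass_pos x).ne', one_mul]
  · ext x
    exact mul_inv_cancel_left₀ (hs x) _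

instance : CompleteSpace (Ell2 m) :=
  (LinearIsometryEquiv.ofSurjective ⟨toLp m, norm_toLp⟩ toLp_surjective).toIsometryEquiv.completeSpace

theorem inner_delta (u : Ell2 m) (x : V) : inner ℝ (delta m x) u = u x * m.mass x := by
  rw [inner_def, tsum_eq_single x]
  · change Set.indicator {x} 1 x * _ * _ = _
    simp
  · intro y hy
    change Set.indicator {x} 1 y * _ * _ = _
    rw [Set.indicator_of_notMem (by simpa using hy)]
    simp

/-- Evaluation at a vertex, as a continuous linear functional. -/
def eval (m : VertexMeasure V) (x : V) : Ell2 m →L[ℝ] ℝ :=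
  (m.mass x)⁻¹ • innerSL ℝ (delta m x)

theorem eval_apply (u : Ell2 m) (x : V) : eval m x u = u x := by
  change (m.mass x)⁻¹ * inner ℝ (delta m x) u = _
  rw [inner_delta, mul_comm (u x), inv_mul_cancel_left₀ (m.mass_pos x).ne']

theorem delta_nonneg (x y : V) : 0 ≤ delta m x y := by
  change 0 ≤ Set.indicator {x} 1 y
  exact Set.indicator_nonneg (fun _ _ => zero_le_one) _

theorem smul_apply (r : ℝ) (u : Ell2 m) (x : V) : (r • u) x = r * u x := rfl

end Ell2

/-! ### Exponentials of bounded operators and contraction estimates. -/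

section Exponential

open NormedSpace

variable {E : Type*} [NormedAddCommGroup E] [NormedSpace ℝ E] [CompleteSpace E]

theorem hasSum_exp_apply (S : E →L[ℝ] E) (f : E) :
    HasSum (fun n : ℕ => (n.factorial : ℝ)⁻¹ • (S ^ n) f) (exp S f) :=
  (exp_series_hasSum_exp' (𝕂 := ℝ) S).mapL (ContinuousLinearMap.apply ℝ E f)

theorem norm_exp_apply_le (S : E →L[ℝ] E) (f : E) : ‖exp S f‖ ≤ Real.exp ‖S‖ * ‖f‖ := by
  have h := (exp_series_hasSum_exp' (𝕂 := ℝ) ‖S‖).mul_right ‖f‖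
  rw [← Real.exp_eq_exp_ℝ] at h
  refine (hasSum_exp_apply S f).norm_le_of_bounded h fun n => ?_
  rw [norm_smul, smul_eq_mul, mul_assoc, Real.norm_of_nonneg (by positivity)]
  refine mul_le_mul_of_nonneg_left ?_ (by positivity)
  induction n with
  | zero => simp
  | succ n ih =>
    rw [pow_succ', pow_succ', mul_assoc]
    exact (S.le_opNorm _).trans (mul_le_mul_of_nonneg_left ih (norm_nonneg _))

theorem exp_add_of_commute_real {S T : E →L[ℝ] E} (h : Commute S T) :
    exp (S + T) = exp S * exp T := by
  let _ : NormedAlgebra ℚ (E →L[ℝ] E) := NormedAlgebra.restrictScalars ℚ ℝ _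
  exact exp_add_of_commute h

/-- Scalars are central, so the exponential factors. Contractivity and positivity of the exponential
can thus be read off from the power series in `K`. -/
theorem exp_neg_smul_one_sub_apply (s : ℝ) (K : E →L[ℝ] E) (f : E) :
    exp (-s • (ContinuousLinearMap.id ℝ E - K)) f = Real.exp (-s) • exp (s • K) f := by
  have h1 : -s • (ContinuousLinearMap.id ℝ E - K)
      = algebraMap ℝ (E →L[ℝ] E) (-s) + s • K := by
    rw [Algebra.algebraMap_eq_smul_one, smul_sub, neg_smul s K, sub_neg_eq_add]
    rfl
  rw [h1, exp_add_of_commute_real (Algebra.commute_algebraMap_left _ _), ← algebraMap_exp_comm,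
    Real.exp_eq_exp_ℝ, Algebra.algebraMap_eq_smul_one]
  rfl

theorem norm_exp_neg_smul_one_sub_le {s : ℝ} (hs : 0 ≤ s) {K : E →L[ℝ] E} (hK : ‖K‖ ≤ 1) (f : E) :
    ‖exp (-s • (ContinuousLinearMap.id ℝ E - K)) f‖ ≤ ‖f‖ := by
  rw [exp_neg_smul_one_sub_apply, norm_smul, Real.norm_of_nonneg (Real.exp_pos _).le]
  have h1 := norm_exp_apply_le (s • K) f
  have h2 : ‖s • K‖ ≤ s := by
    rw [norm_smul, Real.norm_of_nonneg hs]
    exact mul_le_of_le_one_right hs hK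
  calc Real.exp (-s) * ‖exp (s • K) f‖ ≤ Real.exp (-s) * (Real.exp s * ‖f‖) := by
        gcongr
        exact h1.trans (by gcongr)
    _ = ‖f‖ := by rw [← mul_assoc, ← Real.exp_add]; simp

/-- If `S` and `T` commute and generate contraction semigroups, then `e^S f` and `e^T f` are at
distance at most `‖S f - T f‖`. -/
theorem norm_exp_sub_exp_apply_le {S T : E →L[ℝ] E} (h : Commute S T)
    (hS : ∀ s : ℝ, 0 ≤ s → ∀ f, ‖exp (s • S) f‖ ≤ ‖f‖)
    (hT : ∀ s : ℝ, 0 ≤ s → ∀ f, ‖exp (s • T) f‖ ≤ ‖f‖) (f : E) :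
    ‖exp S f - exp T f‖ ≤ ‖S f - T f‖ := by
  -- Interpolate along `T + s(S - T) = sS + (1 - s)T`. For `s ∈ [0, 1]` the exponential there is a
  -- product of two contractions, so the derivative has norm at most `‖(S - T) f‖`.
  have hd : ∀ s : ℝ, HasDerivAt (fun r : ℝ => exp (T + r • (S - T)) f)
      ((exp (T + s • (S - T)) * (S - T)) f) s := fun s => by
    have hc : ∀ r : ℝ, Commute T (r • (S - T)) := fun r =>
      (h.symm.sub_right (Commute.refl T)).smul_right r
    have h1 := (hasDerivAt_exp_smul_const (𝕂 := ℝ) (S - T) s).const_mul (exp T)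
    have h2 : HasDerivAt (fun r : ℝ => exp (T + r • (S - T)))
        (exp (T + s • (S - T)) * (S - T)) s := by
      simp_rw [fun r => exp_add_of_commute_real (hc r), mul_assoc]
      exact h1
    exact ((ContinuousLinearMap.apply ℝ E f).hasFDerivAt.comp_hasDerivAt s h2)
  have h3 := norm_image_sub_le_of_norm_deriv_le_segment_01' (C := ‖S f - T f‖)
    (fun s _ => (hd s).hasDerivWithinAt) fun s hs => ?_
  · simpa using h3
  · have h4 : T + s • (S - T) = s • S + (1 - s) • T := by
      rw [smul_sub, sub_smul, one_smul]; abel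
    rw [h4, exp_add_of_commute_real ((h.smul_left s).smul_right _)]
    exact (hS s hs.1 _).trans (hT _ (by linarith [hs.2]) _)

end Exponential

/-! ### Resolvents, Yosida approximation, and existence and positivity of the semigroup. -/

namespace DirichletForm

open NormedSpace

variable {V : Type*} {m : VertexMeasure V} (Q : DirichletForm m)

section Resolvent

variable {α β : ℝ}

theorem resolvent_eq_iff (hα : 0 < α) (f u : Ell2 m) :
    Q.resolvent α f = u ↔ Q.OperatorGraph u (f - α • u) := by
  rw [resolvent, dif_pos hα]
  exact (Q.exists_resolvent hα).choose_spec f u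

theorem operatorGraph_resolvent (hα : 0 < α) (f : Ell2 m) :
    Q.OperatorGraph (Q.resolvent α f) (f - α • Q.resolvent α f) :=
  (Q.resolvent_eq_iff hα f _).1 rfl

/-- The resolvent as an element of the form domain. -/
def resolventDomain (hα : 0 < α) (f : Ell2 m) : Q.domain :=
  ⟨Q.resolvent α f, (Q.operatorGraph_resolvent hα f).1⟩

theorem form_resolventDomain (hα : 0 < α) (f : Ell2 m) (v : Q.domain) :
    Q.form (Q.resolventDomain hα f) v + α * inner ℝ (Q.resolvent α f) (v : Ell2 m)
      = inner ℝ f (v : Ell2 m) := by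
  have h := (Q.operatorGraph_resolvent hα f).2 v
  rw [inner_sub_left, real_inner_smul_left] at h
  change Q.form (Q.resolventDomain hα f) v = _ at h
  rw [h]
  ring

theorem resolvent_add_smul_resolvent (hα : 0 < α) (hβ : 0 < β) (f : Ell2 m) :
    Q.resolvent α (f + (α - β) • Q.resolvent β f) = Q.resolvent β f := by
  rw [Q.resolvent_eq_iff hα]
  convert Q.operatorGraph_resolvent hβ f using 1
  rw [sub_smul]
  abel

/-- The resolvent identity, read in both orders, expresses `(α - β) R_α R_β f` and `(α - β) R_β R_α
f` both as `R_β f - R_α f`. -/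
theorem commute_resolvent (hα : 0 < α) (hβ : 0 < β) :
    Commute (Q.resolvent α) (Q.resolvent β) := by
  rcases eq_or_ne α β with rfl | hne
  · exact Commute.refl _
  refine ContinuousLinearMap.ext fun f => ?_
  have h1 := Q.resolvent_add_smul_resolvent hα hβ f
  have h2 := Q.resolvent_add_smul_resolvent hβ hα f
  rw [map_add, map_smul] at h1 h2
  have h3 : (α - β) • (Q.resolvent α (Q.resolvent β f) - Q.resolvent β (Q.resolvent α f)) = 0 := by
    rw [smul_sub, sub_eq_zero, eq_sub_of_add_eq' h1, ← neg_sub β α, neg_smul,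
      eq_sub_of_add_eq' h2, neg_sub]
  exact sub_eq_zero.1 ((smul_eq_zero.1 h3).resolve_left (sub_ne_zero.2 hne))

theorem norm_smul_resolvent_apply_le (hα : 0 < α) (f : Ell2 m) :
    ‖α • Q.resolvent α f‖ ≤ ‖f‖ := by
  have h1 := Q.form_resolventDomain hα f (Q.resolventDomain hα f)
  have h2 := real_inner_le_norm f (Q.resolvent α f)
  have h3 := Q.nonneg (Q.resolventDomain hα f)
  change _ + α * inner ℝ (Q.resolvent α f) (Q.resolvent α f) = inner ℝ f (Q.resolvent α f) at h1
  rw [real_inner_self_eq_norm_sq] at h1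
  rw [norm_smul, Real.norm_of_nonneg hα.le]
  rcases (norm_nonneg (Q.resolvent α f)).eq_or_lt with h0 | h0
  · rw [← h0, mul_zero]
    exact norm_nonneg _
  · nlinarith

theorem norm_smul_resolvent_le (hα : 0 < α) : ‖α • Q.resolvent α‖ ≤ 1 :=
  ContinuousLinearMap.opNorm_le_bound _ zero_le_one fun f => by
    rw [one_mul]
    exact Q.norm_smul_resolvent_apply_le hα f

/-- With `r = R_α g` and `d = g - α r`, testing the resolvent equation on `d` gives `‖d‖² = Q(r,
d)`, hence `α‖d‖² = Q(g, d) - Q(d, d)`. Now `Q(g - d) ≥ 0` bounds the right side by `Q(g, g)`. -/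
theorem norm_sub_smul_resolvent_sq_le (hα : 0 < α) (g : Q.domain) :
    ‖(g : Ell2 m) - α • Q.resolvent α g‖ ^ 2 ≤ Q.form g g / α := by
  set r : Q.domain := Q.resolventDomain hα g with hr
  set d : Q.domain := g - α • r with hd
  have hd' : (d : Ell2 m) = g - α • Q.resolvent α g := rfl
  have h1 := Q.form_resolventDomain hα g d
  rw [← hr] at h1
  have h2 : Q.form d d = Q.form g d - α * Q.form r d := by
    rw [show Q.form d = Q.form g - α • Q.form r by rw [hd, map_sub, map_smul]]
    rfl
  have h3 : ‖(d : Ell2 m)‖ ^ 2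
      = inner ℝ (g : Ell2 m) (d : Ell2 m) - α * inner ℝ (Q.resolvent α g) (d : Ell2 m) := by
    rw [← real_inner_self_eq_norm_sq, ← real_inner_smul_left, ← inner_sub_left, ← hd']
  have h4 : 0 ≤ Q.form (g - d) (g - d) := Q.nonneg _
  have h5 := Q.nonneg g
  have h6 := Q.nonneg d
  simp only [map_sub, LinearMap.sub_apply, Q.symm d g] at h4
  rw [← hd', le_div_iff₀ hα]
  nlinarith

theorem tendsto_smul_resolvent (f : Ell2 m) :
    Tendsto (fun α : ℝ => α • Q.resolvent α f) atTop (𝓝 f) := by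
  refine Metric.tendsto_atTop.2 fun ε hε => ?_
  obtain ⟨g, hg, hfg⟩ := Metric.mem_closure_iff.1 (Q.dense_domain f) (ε / 4) (by positivity)
  rw [dist_eq_norm] at hfg
  set q := Q.form ⟨g, hg⟩ ⟨g, hg⟩
  have hq : 0 ≤ q := Q.nonneg _
  refine ⟨q / (ε / 4) ^ 2 + 1, fun α hα => ?_⟩
  have hα0 : 0 < α := lt_of_lt_of_le (by positivity) hα
  have h1 : ‖g - α • Q.resolvent α g‖ ^ 2 ≤ q / α :=
    Q.norm_sub_smul_resolvent_sq_le hα0 ⟨g, hg⟩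
  have h2 : q / α ≤ (ε / 4) ^ 2 := by
    rw [div_le_iff₀ hα0, ← div_le_iff₀' (by positivity)]
    linarith
  have h3 : ‖g - α • Q.resolvent α g‖ ≤ ε / 4 := le_of_sq_le_sq (h1.trans h2) (by positivity)
  have h4 := Q.norm_smul_resolvent_apply_le hα0 (f - g)
  have h5 : α • Q.resolvent α f - f
      = α • Q.resolvent α (f - g) - (g - α • Q.resolvent α g) - (f - g) := by
    rw [map_sub, smul_sub]
    abel
  rw [dist_eq_norm, h5]
  have h6 := norm_sub_le (α • Q.resolvent α (f - g) - (g - α • Q.resolvent α g)) (f - g)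
  have h7 := norm_sub_le (α • Q.resolvent α (f - g)) (g - α • Q.resolvent α g)
  linarith

/-- `u = R_α f` is the unique minimiser of `Q(v) + α‖v‖² - 2⟨f, v⟩`. Replacing `u` by `|u|` does not
increase this functional when `f ≥ 0`, so `u = |u|`. -/
theorem resolvent_nonneg (hα : 0 < α) {f : Ell2 m} (hf : ∀ x, 0 ≤ f x) (x : V) :
    0 ≤ Q.resolvent α f x := by
  set u := Q.resolventDomain hα f with hu
  obtain ⟨w, hw, hwu⟩ := Q.markov (fun t => |t|) abs_zero (fun s t => abs_abs_sub_abs_le s t) u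
  have h1 : inner ℝ (w : Ell2 m) (w : Ell2 m) = inner ℝ (u : Ell2 m) (u : Ell2 m) := by
    rw [Ell2.inner_def, Ell2.inner_def]
    exact tsum_congr fun x => by rw [hw, abs_mul_abs_self]
  have h2 : inner ℝ f (u : Ell2 m) ≤ inner ℝ f (w : Ell2 m) := by
    rw [Ell2.inner_def, Ell2.inner_def]
    refine (Ell2.summable_mul f u.1).tsum_le_tsum (fun x => ?_) (Ell2.summable_mul f w.1)
    rw [hw]
    exact mul_le_mul_of_nonneg_right (mul_le_mul_of_nonneg_left (le_abs_self _) (hf x))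
      (m.mass_pos x).le
  have h3 := Q.form_resolventDomain hα f u
  have h4 := Q.form_resolventDomain hα f w
  rw [← hu] at h3 h4
  change _ + α * inner ℝ (u : Ell2 m) (u : Ell2 m) = _ at h3
  change _ + α * inner ℝ (u : Ell2 m) (w : Ell2 m) = _ at h4
  have h5 : ‖(w - u : Ell2 m)‖ ^ 2 ≤ 0 := by
    have h6 := Q.nonneg (w - u)
    simp only [map_sub, LinearMap.sub_apply, Q.symm w u] at h6
    rw [← real_inner_self_eq_norm_sq, inner_sub_left, inner_sub_right, inner_sub_right, h1,
      real_inner_comm (u : Ell2 m) (w : Ell2 m)]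
    nlinarith
  have h7 : (w - u : Ell2 m) = 0 := by
    rw [← norm_eq_zero]
    exact pow_eq_zero_iff two_ne_zero |>.1 (le_antisymm h5 (sq_nonneg _))
  have h8 : u.1 x = w.1 x := by rw [sub_eq_zero.1 h7]
  change 0 ≤ u.1 x
  rw [h8, hw]
  exact abs_nonneg _

end Resolvent

/-- The Yosida approximation `α L (L + α)⁻¹` of `L`. -/
def yosida (α : ℝ) : Ell2 m →L[ℝ] Ell2 m :=
  α • (ContinuousLinearMap.id ℝ (Ell2 m) - α • Q.resolvent α)

theorem semigroup_def (t : ℝ) (f : Ell2 m) :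
    Q.semigroup t f = limUnder atTop fun α : ℝ => exp (-t • Q.yosida α) f := by
  simp only [semigroup, yosida, smul_smul, neg_mul]

theorem commute_yosida {α β : ℝ} (hα : 0 < α) (hβ : 0 < β) :
    Commute (Q.yosida α) (Q.yosida β) := by
  have h := ((Q.commute_resolvent hα hβ).smul_left α).smul_right β
  have h1 : Commute (ContinuousLinearMap.id ℝ (Ell2 m) - α • Q.resolvent α)
      (ContinuousLinearMap.id ℝ (Ell2 m) - β • Q.resolvent β) :=
    ((Commute.one_left _).sub_left ((Commute.one_right _).sub_right h))
  exact (h1.smul_left α).smul_right β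

theorem norm_exp_yosida_le {α t : ℝ} (hα : 0 < α) (ht : 0 ≤ t) (f : Ell2 m) :
    ‖exp (-t • Q.yosida α) f‖ ≤ ‖f‖ := by
  rw [yosida, smul_smul, neg_mul]
  exact norm_exp_neg_smul_one_sub_le (mul_nonneg ht hα.le) (Q.norm_smul_resolvent_le hα) f

theorem norm_exp_yosida_sub_le {α β t : ℝ} (hα : 0 < α) (hβ : 0 < β) (ht : 0 ≤ t) (f : Ell2 m) :
    ‖exp (-t • Q.yosida α) f - exp (-t • Q.yosida β) f‖ ≤ t * ‖Q.yosida α f - Q.yosida β f‖ := by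
  have hc : ∀ {γ : ℝ}, 0 < γ → ∀ s : ℝ, 0 ≤ s → ∀ f, ‖exp (s • -t • Q.yosida γ) f‖ ≤ ‖f‖ := by
    intro γ hγ s hs f
    rw [smul_smul, mul_neg]
    exact Q.norm_exp_yosida_le hγ (mul_nonneg hs ht) f
  refine (norm_exp_sub_exp_apply_le (((Q.commute_yosida hα hβ).smul_left _).smul_right _)
    (hc hα) (hc hβ) f).trans_eq ?_
  change ‖-t • Q.yosida α f - -t • Q.yosida β f‖ = _
  rw [← smul_sub, norm_smul, norm_neg, Real.norm_of_nonneg ht]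

theorem yosida_of_operatorGraph {α : ℝ} (hα : 0 < α) {u w : Ell2 m} (h : Q.OperatorGraph u w) :
    Q.yosida α u = α • Q.resolvent α w := by
  have h1 : Q.resolvent α (w + α • u) = u := by
    rw [Q.resolvent_eq_iff hα]
    simpa using h
  rw [map_add, map_smul] at h1
  change α • (u - α • Q.resolvent α u) = _
  rw [← eq_sub_of_add_eq h1]

theorem tendsto_yosida {u w : Ell2 m} (h : Q.OperatorGraph u w) :
    Tendsto (fun α => Q.yosida α u) atTop (𝓝 w) := by
  refine (Q.tendsto_smul_resolvent w).congr' ?_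
  filter_upwards [eventually_gt_atTop 0] with α hα
  exact (Q.yosida_of_operatorGraph hα h).symm

/-- On `D(L)` the Yosida approximations converge, so their exponentials are Cauchy by
`norm_exp_yosida_sub_le`. The vectors `γ R_γ f` lie in `D(L)` and approximate `f`; contractivity
carries the Cauchy property over to `f`. -/
theorem tendsto_exp_yosida {t : ℝ} (ht : 0 ≤ t) (f : Ell2 m) :
    Tendsto (fun α : ℝ => exp (-t • Q.yosida α) f) atTop (𝓝 (Q.semigroup t f)) := by
  rw [semigroup_def]
  refine tendsto_nhds_limUnder ?_
  refine cauchySeq_tendsto_of_complete (Metric.cauchySeq_iff.2 fun ε hε => ?_)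
  obtain ⟨γ, hγ, hγ0⟩ := ((Metric.tendsto_nhds.1 (Q.tendsto_smul_resolvent f) (ε / 4)
    (by positivity)).and (eventually_gt_atTop 0)).exists
  rw [dist_eq_norm, norm_sub_rev] at hγ
  set g := γ • Q.resolvent γ f with hg
  have hL : Q.OperatorGraph (Q.resolvent γ f) (f - γ • Q.resolvent γ f) :=
    Q.operatorGraph_resolvent hγ0 f
  have hy := ((Q.tendsto_yosida hL).const_smul γ).cauchySeq
  -- The factor `t` in the estimate on `g` is absorbed by `t + 1`, which stays positive at `t = 0`.
  obtain ⟨N, hN⟩ := Metric.cauchySeq_iff.1 hy (ε / (4 * (t + 1))) (by positivity)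
  refine ⟨max N 1, fun α hα β hβ => ?_⟩
  have hα0 : 0 < α := one_pos.trans_le ((le_max_right _ _).trans hα)
  have hβ0 : 0 < β := one_pos.trans_le ((le_max_right _ _).trans hβ)
  have h1 := hN α ((le_max_left _ _).trans hα) β ((le_max_left _ _).trans hβ)
  rw [dist_eq_norm, ← map_smul (Q.yosida α), ← map_smul (Q.yosida β), ← hg,
    lt_div_iff₀ (by positivity)] at h1
  have h2 := Q.norm_exp_yosida_sub_le hα0 hβ0 ht g
  have h3 := Q.norm_exp_yosida_le hα0 ht (f - g)
  have h4 := Q.norm_exp_yosida_le hβ0 ht (f - g)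
  have h5 : exp (-t • Q.yosida α) f - exp (-t • Q.yosida β) f
      = exp (-t • Q.yosida α) (f - g) - exp (-t • Q.yosida β) (f - g)
        + (exp (-t • Q.yosida α) g - exp (-t • Q.yosida β) g) := by
    rw [map_sub, map_sub]
    abel
  rw [dist_eq_norm, h5]
  have h6 := norm_add_le (exp (-t • Q.yosida α) (f - g) - exp (-t • Q.yosida β) (f - g))
    (exp (-t • Q.yosida α) g - exp (-t • Q.yosida β) g)
  have h7 := norm_sub_le (exp (-t • Q.yosida α) (f - g)) (exp (-t • Q.yosida β) (f - g))
  nlinarith [norm_nonneg (Q.yosida α g - Q.yosida β g)]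

theorem norm_semigroup_le {t : ℝ} (ht : 0 ≤ t) (f : Ell2 m) : ‖Q.semigroup t f‖ ≤ ‖f‖ := by
  refine le_of_tendsto (Q.tendsto_exp_yosida ht f).norm ?_
  filter_upwards [eventually_gt_atTop 0] with α hα
  exact Q.norm_exp_yosida_le hα ht f

/-- The operator is `e^{-tα}` times the exponential series of `tα · α R_α`, and every power of the
positivity-preserving `α R_α` preserves positivity. -/
theorem exp_yosida_nonneg {α t : ℝ} (hα : 0 < α) (ht : 0 ≤ t) {f : Ell2 m} (hf : ∀ x, 0 ≤ f x)
    (x : V) : 0 ≤ exp (-t • Q.yosida α) f x := by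
  rw [yosida, smul_smul, neg_mul, exp_neg_smul_one_sub_apply, Ell2.smul_apply]
  refine mul_nonneg (Real.exp_pos _).le ?_
  have hp : ∀ n : ℕ, ∀ y, 0 ≤ (((t * α) • α • Q.resolvent α) ^ n) f y := by
    intro n
    induction n with
    | zero => exact hf
    | succ n ih =>
      intro y
      rw [pow_succ']
      change 0 ≤ ((t * α) • α • Q.resolvent α ((((t * α) • α • Q.resolvent α) ^ n) f)) y
      rw [Ell2.smul_apply, Ell2.smul_apply]
      exact mul_nonneg (mul_nonneg ht hα.le) (mul_nonneg hα.le (Q.resolvent_nonneg hα ih y))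
  refine ((hasSum_exp_apply ((t * α) • α • Q.resolvent α) f).mapL (Ell2.eval m x)).nonneg
    (fun n => ?_) |>.trans_eq (Ell2.eval_apply _ _)
  rw [Ell2.eval_apply, Ell2.smul_apply]
  exact mul_nonneg (by positivity) (hp n x)

theorem semigroup_nonneg {t : ℝ} (ht : 0 ≤ t) {f : Ell2 m} (hf : ∀ x, 0 ≤ f x) (x : V) :
    0 ≤ Q.semigroup t f x := by
  rw [← Ell2.eval_apply]
  refine ge_of_tendsto (((Ell2.eval m x).continuous.tendsto _).comp (Q.tendsto_exp_yosida ht f)) ?_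
  filter_upwards [eventually_gt_atTop 0] with α hα
  rw [Function.comp_apply, Ell2.eval_apply]
  exact Q.exp_yosida_nonneg hα ht hf x

end DirichletForm

/-! ### The Green function as a monotone limit of resolvent kernels. -/

namespace DirichletForm

open NormedSpace MeasureTheory

variable {V : Type*} {m : VertexMeasure V} (Q : DirichletForm m)

theorem _root_.hasDerivAt_exp_neg_smul_apply {E : Type*} [NormedAddCommGroup E] [NormedSpace ℝ E]
    [CompleteSpace E] (S : E →L[ℝ] E) (u : E) (t : ℝ) :
    HasDerivAt (fun t : ℝ => exp (-t • S) u) (-exp (-t • S) (S u)) t := by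
  have h1 := hasDerivAt_exp_smul_const (𝕂 := ℝ) (-S) t
  simp only [smul_neg, mul_neg, ← neg_smul] at h1
  have h2 := (ContinuousLinearMap.apply ℝ E u).hasFDerivAt.comp_hasDerivAt t h1
  simpa [Function.comp_def] using h2

theorem _root_.continuous_exp_neg_smul_apply {E : Type*} [NormedAddCommGroup E] [NormedSpace ℝ E]
    [CompleteSpace E] (S : E →L[ℝ] E) (u : E) : Continuous fun t : ℝ => exp (-t • S) u :=
  continuous_iff_continuousAt.2 fun t => (hasDerivAt_exp_neg_smul_apply S u t).continuousAt

theorem integrableOn_exp_smul_exp_yosida {α l : ℝ} (hα : 0 < α) (hl : 0 < l) (f : Ell2 m) :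
    IntegrableOn (fun t : ℝ => Real.exp (-l * t) • exp (-t • Q.yosida α) f) (Set.Ioi 0) := by
  refine ((exp_neg_integrableOn_Ioi 0 hl).mul_const ‖f‖).mono' ?_ ?_
  · have h1 : Continuous fun t : ℝ => Real.exp (-l * t) := by fun_prop
    exact (h1.smul (continuous_exp_neg_smul_apply _ f)).aestronglyMeasurable
  · filter_upwards [ae_restrict_mem measurableSet_Ioi] with t ht
    rw [norm_smul, Real.norm_of_nonneg (Real.exp_pos _).le]
    exact mul_le_mul_of_nonneg_left (Q.norm_exp_yosida_le hα (le_of_lt ht) f) (Real.exp_pos _).le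

/-- The integrand is the derivative of `-e^{-lt} e^{-tL_α} u`, which vanishes at infinity. Applying
it to `(l + L_α) u` avoids inverting `l + L_α`. -/
theorem integral_exp_smul_exp_yosida {α l : ℝ} (hα : 0 < α) (hl : 0 < l) (u : Ell2 m) :
    ∫ t in Set.Ioi (0 : ℝ), Real.exp (-l * t) • exp (-t • Q.yosida α) (l • u + Q.yosida α u)
      = u := by
  have hd : ∀ t : ℝ, HasDerivAt (fun t : ℝ => -(Real.exp (-l * t) • exp (-t • Q.yosida α) u))
      (Real.exp (-l * t) • exp (-t • Q.yosida α) (l • u + Q.yosida α u)) t := fun t => by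
    have h1 : HasDerivAt (fun t : ℝ => Real.exp (-l * t)) (Real.exp (-l * t) * (-l)) t := by
      simpa using ((hasDerivAt_id t).const_mul (-l)).exp
    convert (h1.smul (hasDerivAt_exp_neg_smul_apply (Q.yosida α) u t)).neg using 1
    · rfl
    rw [map_add, map_smul]
    module
  rw [integral_Ioi_of_hasDerivAt_of_tendsto' (fun t _ => hd t)
    (Q.integrableOn_exp_smul_exp_yosida hα hl _) (m := 0)]
  · simp
  · rw [← neg_zero]
    refine Tendsto.neg (squeeze_zero_norm' (a := fun t => Real.exp (-l * t) * ‖u‖) ?_ ?_)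
    · filter_upwards [eventually_ge_atTop 0] with t ht
      rw [norm_smul, Real.norm_of_nonneg (Real.exp_pos _).le]
      exact mul_le_mul_of_nonneg_left (Q.norm_exp_yosida_le hα ht u) (Real.exp_pos _).le
    · have h2 : Tendsto (fun t : ℝ => -l * t) atTop atBot :=
        tendsto_id.const_mul_atTop_of_neg (neg_neg_of_pos hl)
      simpa using (Real.tendsto_exp_atBot.comp h2).mul_const ‖u‖

theorem _root_.tendsto_natCast_add_one_atTop : Tendsto (fun n : ℕ => (n : ℝ) + 1) atTop atTop :=
  tendsto_atTop_add_const_right _ _ tendsto_natCast_atTop_atTop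

theorem aestronglyMeasurable_semigroup (f : Ell2 m) :
    AEStronglyMeasurable (fun t : ℝ => Q.semigroup t f) (volume.restrict (Set.Ioi 0)) := by
  refine aestronglyMeasurable_of_tendsto_ae atTop
    (f := fun (n : ℕ) (t : ℝ) => exp (-t • Q.yosida (n + 1)) f)
    (fun n => (continuous_exp_neg_smul_apply _ f).aestronglyMeasurable) ?_
  filter_upwards [ae_restrict_mem measurableSet_Ioi] with t ht
  exact (Q.tendsto_exp_yosida (le_of_lt ht) f).comp tendsto_natCast_add_one_atTop

theorem integrableOn_exp_smul_semigroup {l : ℝ} (hl : 0 < l) (f : Ell2 m) :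
    IntegrableOn (fun t : ℝ => Real.exp (-l * t) • Q.semigroup t f) (Set.Ioi 0) := by
  refine ((exp_neg_integrableOn_Ioi 0 hl).mul_const ‖f‖).mono' ?_ ?_
  · have h1 : Continuous fun t : ℝ => Real.exp (-l * t) := by fun_prop
    exact h1.aestronglyMeasurable.smul (Q.aestronglyMeasurable_semigroup f)
  · filter_upwards [ae_restrict_mem measurableSet_Ioi] with t ht
    rw [norm_smul, Real.norm_of_nonneg (Real.exp_pos _).le]
    exact mul_le_mul_of_nonneg_left (Q.norm_semigroup_le (le_of_lt ht) f) (Real.exp_pos _).le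

/-- The resolvent is the Laplace transform of the semigroup. -/
theorem integral_exp_smul_semigroup {l : ℝ} (hl : 0 < l) (f : Ell2 m) :
    ∫ t in Set.Ioi (0 : ℝ), Real.exp (-l * t) • Q.semigroup t f = Q.resolvent l f := by
  set u := Q.resolvent l f with hu
  have hL : Q.OperatorGraph u (f - l • u) := Q.operatorGraph_resolvent hl f
  -- `g n = (l + L_{n+1}) u` converges to `(l + L) u = f`, while the approximate Laplace transform
  -- of `g n` is exactly `u` for every `n`.
  set g : ℕ → Ell2 m := fun n => l • u + Q.yosida (n + 1) u with hgdef
  have hpos : ∀ n : ℕ, (0 : ℝ) < n + 1 := fun n => by positivity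
  have hg : Tendsto g atTop (𝓝 f) := by
    have := ((Q.tendsto_yosida hL).comp tendsto_natCast_add_one_atTop).const_add (l • u)
    rwa [add_sub_cancel] at this
  obtain ⟨C, hC⟩ := (Metric.isBounded_range_of_tendsto g hg).exists_norm_le
  have hlim := tendsto_integral_of_dominated_convergence (μ := volume.restrict (Set.Ioi (0 : ℝ)))
    (F := fun (n : ℕ) (t : ℝ) => Real.exp (-l * t) • exp (-t • Q.yosida (n + 1)) (g n))
    (f := fun t => Real.exp (-l * t) • Q.semigroup t f)
    (fun t => Real.exp (-l * t) * C)
    (fun n => (Q.integrableOn_exp_smul_exp_yosida (hpos n) hl _).aestronglyMeasurable)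
    ((exp_neg_integrableOn_Ioi 0 hl).mul_const C) (fun n => ?_) ?_
  · refine tendsto_nhds_unique hlim ?_
    simp only [hgdef, Q.integral_exp_smul_exp_yosida (hpos _) hl]
    exact tendsto_const_nhds
  · filter_upwards [ae_restrict_mem measurableSet_Ioi] with t ht
    rw [norm_smul, Real.norm_of_nonneg (Real.exp_pos _).le]
    exact mul_le_mul_of_nonneg_left ((Q.norm_exp_yosida_le (hpos n) (le_of_lt ht) _).trans
      (hC _ ⟨n, rfl⟩)) (Real.exp_pos _).le
  · filter_upwards [ae_restrict_mem measurableSet_Ioi] with t ht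
    refine Tendsto.const_smul ?_ _
    have h1 := (Q.tendsto_exp_yosida (le_of_lt ht) f).comp tendsto_natCast_add_one_atTop
    have h2 : Tendsto (fun n : ℕ => exp (-t • Q.yosida (n + 1)) (g n - f)) atTop (𝓝 0) :=
      squeeze_zero_norm (fun n => Q.norm_exp_yosida_le (hpos n) (le_of_lt ht) _)
        (tendsto_iff_norm_sub_tendsto_zero.1 hg)
    simpa using h1.add h2

theorem ofReal_resolvent_eq_lintegral {l : ℝ} (hl : 0 < l) (x y : V) :
    ENNReal.ofReal (Q.resolvent l (Ell2.delta m x) y)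
      = ∫⁻ t in Set.Ioi (0 : ℝ),
          ENNReal.ofReal (Real.exp (-l * t) * Q.semigroup t (Ell2.delta m x) y) := by
  have hi := Q.integrableOn_exp_smul_semigroup hl (Ell2.delta m x)
  rw [← Q.integral_exp_smul_semigroup hl, ← Ell2.eval_apply,
    ← ContinuousLinearMap.integral_comp_comm _ hi,
    ofReal_integral_eq_lintegral_ofReal ((Ell2.eval m y).integrable_comp hi)]
  · simp only [Ell2.eval_apply, Ell2.smul_apply]
  · filter_upwards [ae_restrict_mem measurableSet_Ioi] with t ht
    rw [Ell2.eval_apply, Ell2.smul_apply]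
    exact mul_nonneg (Real.exp_pos _).le
      (Q.semigroup_nonneg (le_of_lt ht) (Ell2.delta_nonneg x) y)

/-- Monotone convergence in the Laplace integral: positivity of the semigroup makes the integrands
increase as the parameter decreases to `0`. -/
theorem tendsto_resolvent_green (x y : V) :
    Tendsto (fun n : ℕ => ENNReal.ofReal (Q.resolvent ((n : ℝ) + 1)⁻¹ (Ell2.delta m x) y)) atTop
      (𝓝 (Q.green x y)) := by
  have hpos : ∀ n : ℕ, (0 : ℝ) < ((n : ℝ) + 1)⁻¹ := fun n => by positivity
  simp only [Q.ofReal_resolvent_eq_lintegral (hpos _)]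
  refine lintegral_tendsto_of_tendsto_of_monotone (fun n => ?_) ?_ ?_
  · have hi := (Ell2.eval m y).integrable_comp
      (Q.integrableOn_exp_smul_semigroup (hpos n) (Ell2.delta m x))
    simp only [Ell2.eval_apply, Ell2.smul_apply] at hi
    exact hi.aestronglyMeasurable.aemeasurable.ennreal_ofReal
  · filter_upwards [ae_restrict_mem measurableSet_Ioi] with t ht
    intro k n hkn
    refine ENNReal.ofReal_le_ofReal (mul_le_mul_of_nonneg_right ?_
      (Q.semigroup_nonneg (le_of_lt ht) (Ell2.delta_nonneg x) y))
    refine Real.exp_le_exp.2 (mul_le_mul_of_nonneg_right (neg_le_neg ?_) (le_of_lt ht))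
    gcongr
  · filter_upwards [ae_restrict_mem measurableSet_Ioi] with t ht
    refine ENNReal.tendsto_ofReal ?_
    have h1 : Tendsto (fun n : ℕ => Real.exp (-((n : ℝ) + 1)⁻¹ * t)) atTop (𝓝 1) := by
      have h2 := (tendsto_inv_atTop_zero.comp tendsto_natCast_add_one_atTop).neg.mul_const t
      simpa [Function.comp_def] using (Real.continuous_exp.tendsto _).comp h2
    simpa using h1.mul_const (Q.semigroup t (Ell2.delta m x) y)

end DirichletForm

/-! ### The graph energy as a weighted square sum. -/

namespace WeightedGraph

variable {V : Type*} (G : WeightedGraph V)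

/-- The weights of the terms of the energy: one term for each ordered pair of vertices and one for
each vertex. -/
def weight : (V × V) ⊕ V → ℝ := Sum.elim (fun p => 1 / 2 * G.b p.1 p.2) G.c

/-- The increments of `u` along pairs of vertices, together with the values of `u`. -/
def increment : (V → ℝ) →ₗ[ℝ] ((V × V) ⊕ V → ℝ) where
  toFun u := Sum.elim (fun p => u p.1 - u p.2) u
  map_add' u v := by
    ext (p | x)
    · exact add_sub_add_comm _ _ _ _
    · rfl
  map_smul' r u := by
    ext (p | x)
    · exact (mul_sub _ _ _).symm
    · rfl

variable {u v : V → ℝ}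

theorem weight_nonneg (i : (V × V) ⊕ V) : 0 ≤ G.weight i := by
  rcases i with p | x
  · exact mul_nonneg (by norm_num) (G.b_nonneg _ _)
  · exact G.c_nonneg x

/-- Edges and killing become one index set, so the energy is a single weighted square sum of a
linear map and each later estimate is termwise. -/
theorem energy_eq_tsum (u : V → ℝ) :
    G.energy u = ∑' i, ENNReal.ofReal (G.weight i * increment u i ^ 2) := by
  rw [Summable.tsum_sum ENNReal.summable ENNReal.summable, energy, ← ENNReal.tsum_mul_left]
  congr 1
  refine tsum_congr fun p => ?_
  have h2 : (1 / 2 : ℝ≥0∞) = ENNReal.ofReal (1 / 2) := by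
    rw [ENNReal.ofReal_div_of_pos two_pos]
    simp
  rw [h2, ← ENNReal.ofReal_mul (by norm_num), ← mul_assoc]
  rfl

theorem summable_weight_sq (hu : G.energy u < ∞) :
    Summable fun i => G.weight i * increment u i ^ 2 := by
  rw [energy_eq_tsum] at hu
  exact (ENNReal.summable_toReal hu.ne).congr fun i =>
    ENNReal.toReal_ofReal (mul_nonneg (G.weight_nonneg i) (sq_nonneg _))

theorem summable_weight_mul (hu : G.energy u < ∞) (hv : G.energy v < ∞) :
    Summable fun i => G.weight i * increment u i * increment v i := by
  refine Summable.of_norm_bounded ((G.summable_weight_sq hu).add (G.summable_weight_sq hv))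
    fun i => ?_
  have hw := G.weight_nonneg i
  rw [Real.norm_eq_abs, mul_assoc, abs_mul, abs_of_nonneg hw, ← mul_add]
  refine mul_le_mul_of_nonneg_left ?_ hw
  rw [abs_le]
  constructor <;> nlinarith [sq_nonneg (increment u i - increment v i),
    sq_nonneg (increment u i + increment v i)]

theorem energyForm_eq_tsum (hu : G.energy u < ∞) (hv : G.energy v < ∞) :
    G.energyForm u v = ∑' i, G.weight i * increment u i * increment v i := by
  have h := G.summable_weight_mul hu hv
  rw [Summable.tsum_sum (h.comp_injective Sum.inl_injective)
    (h.comp_injective Sum.inr_injective), energyForm, ← tsum_mul_left]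
  congr 1
  refine tsum_congr fun p => ?_
  rw [← mul_assoc, ← mul_assoc]
  rfl

theorem ofReal_energyForm_self (hu : G.energy u < ∞) :
    ENNReal.ofReal (G.energyForm u u) = G.energy u := by
  rw [G.energyForm_eq_tsum hu hu, energy_eq_tsum]
  simp only [mul_assoc, ← sq]
  exact ENNReal.ofReal_tsum_of_nonneg (fun i => mul_nonneg (G.weight_nonneg i) (sq_nonneg _))
    (G.summable_weight_sq hu)

theorem energyForm_comm (u v : V → ℝ) : G.energyForm u v = G.energyForm v u := by
  simp only [energyForm, mul_right_comm]

theorem energyForm_self_nonneg (u : V → ℝ) : 0 ≤ G.energyForm u u := by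
  refine add_nonneg (mul_nonneg (by norm_num) (tsum_nonneg fun p => ?_)) (tsum_nonneg fun x => ?_)
  · rw [mul_assoc]
    exact mul_nonneg (G.b_nonneg _ _) (mul_self_nonneg _)
  · rw [mul_assoc]
    exact mul_nonneg (G.c_nonneg _) (mul_self_nonneg _)

/-- Termwise `(a + b)² ≤ 2a² + 2b²`; this stands in for the triangle inequality and needs no
finiteness. -/
theorem energy_add_le (u v : V → ℝ) : G.energy (u + v) ≤ 2 * G.energy u + 2 * G.energy v := by
  simp only [energy_eq_tsum]
  rw [← ENNReal.tsum_mul_left, ← ENNReal.tsum_mul_left, ← ENNReal.tsum_add]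
  refine ENNReal.tsum_le_tsum fun i => ?_
  have hw := G.weight_nonneg i
  rw [← ENNReal.ofReal_ofNat 2, ← ENNReal.ofReal_mul zero_le_two, ← ENNReal.ofReal_mul zero_le_two,
    ← ENNReal.ofReal_add (by positivity) (by positivity)]
  refine ENNReal.ofReal_le_ofReal ?_
  rw [map_add, Pi.add_apply]
  nlinarith [mul_nonneg hw (sq_nonneg (increment u i - increment v i))]

theorem energy_smul (r : ℝ) (u : V → ℝ) :
    G.energy (r • u) = ENNReal.ofReal (r ^ 2) * G.energy u := by
  simp only [energy_eq_tsum]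
  rw [← ENNReal.tsum_mul_left]
  refine tsum_congr fun i => ?_
  rw [← ENNReal.ofReal_mul (sq_nonneg r), map_smul, Pi.smul_apply, smul_eq_mul]
  congr 1
  ring

theorem energy_sub_comm (u v : V → ℝ) : G.energy (u - v) = G.energy (v - u) := by
  rw [← neg_sub, ← neg_one_smul ℝ, energy_smul]
  simp

theorem energyForm_add_left {w : V → ℝ} (hu : G.energy u < ∞) (hv : G.energy v < ∞)
    (hw : G.energy w < ∞) : G.energyForm (u + v) w = G.energyForm u w + G.energyForm v w := by
  have huv : G.energy (u + v) < ∞ := (G.energy_add_le u v).trans_lt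
    (ENNReal.add_lt_top.2 ⟨ENNReal.mul_lt_top (by simp) hu, ENNReal.mul_lt_top (by simp) hv⟩)
  rw [G.energyForm_eq_tsum huv hw, G.energyForm_eq_tsum hu hw, G.energyForm_eq_tsum hv hw,
    ← (G.summable_weight_mul hu hw).tsum_add (G.summable_weight_mul hv hw)]
  refine tsum_congr fun i => ?_
  rw [map_add, Pi.add_apply]
  ring

theorem energyForm_smul_left (r : ℝ) (hu : G.energy u < ∞) (hv : G.energy v < ∞) :
    G.energyForm (r • u) v = r * G.energyForm u v := by
  have hru : G.energy (r • u) < ∞ := by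
    rw [energy_smul]
    exact ENNReal.mul_lt_top ENNReal.ofReal_lt_top hu
  rw [G.energyForm_eq_tsum hru hv, G.energyForm_eq_tsum hu hv, ← tsum_mul_left]
  refine tsum_congr fun i => ?_
  rw [map_smul, Pi.smul_apply, smul_eq_mul]
  ring

/-- Lower semicontinuity of the energy under pointwise convergence. -/
theorem energy_le_of_tendsto {u : ℕ → V → ℝ} {C : ℝ≥0∞}
    (hv : ∀ x, Tendsto (fun n => u n x) atTop (𝓝 (v x)))
    (hC : ∀ᶠ n in atTop, G.energy (u n) ≤ C) : G.energy v ≤ C := by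
  rw [energy_eq_tsum, ENNReal.tsum_eq_iSup_sum]
  refine iSup_le fun s => ?_
  have hi : ∀ i, Tendsto (fun n => increment (u n) i) atTop (𝓝 (increment v i)) := by
    rintro (p | x)
    · exact (hv p.1).sub (hv p.2)
    · exact hv x
  refine le_of_tendsto (tendsto_finsetSum s fun i _ =>
    ENNReal.tendsto_ofReal (((hi i).pow 2).const_mul (G.weight i))) ?_
  filter_upwards [hC] with n hn
  refine le_trans ?_ hn
  rw [energy_eq_tsum]
  exact ENNReal.sum_le_tsum s

theorem weight_mul_sq_le (hu : G.energy u < ∞) (i : (V × V) ⊕ V) :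
    G.weight i * increment u i ^ 2 ≤ G.energyForm u u := by
  rw [← ENNReal.ofReal_le_ofReal_iff (G.energyForm_self_nonneg u), G.ofReal_energyForm_self hu,
    energy_eq_tsum]
  exact ENNReal.le_tsum i

theorem abs_sub_le_of_connected (hG : G.Connected) (x y : V) :
    ∃ C : ℝ, ∀ u : V → ℝ, G.energy u < ∞ → |u x - u y| ≤ C * √(G.energyForm u u) := by
  induction hG x y with
  | refl => exact ⟨0, fun u _ => by simp⟩
  | @tail z w _ hzw ih =>
    obtain ⟨C, hC⟩ := ih
    -- The ordered pair `(z, w)` alone contributes `b(z, w)/2 · (u z - u w)²` to the energy.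
    refine ⟨C + √(2 / G.b z w), fun u hu => ?_⟩
    have h1 : 1 / 2 * G.b z w * (u z - u w) ^ 2 ≤ G.energyForm u u :=
      G.weight_mul_sq_le hu (Sum.inl (z, w))
    have h2 : |u z - u w| ≤ √(2 / G.b z w) * √(G.energyForm u u) := by
      rw [← Real.sqrt_mul (by positivity)]
      refine Real.abs_le_sqrt ?_
      rw [div_mul_eq_mul_div, le_div_iff₀ hzw]
      linarith
    have h3 := abs_sub_le (u x) (u z) (u w)
    linarith [hC u hu]

end WeightedGraph

/-- Apply lower semicontinuity to `u k - u l` as `l → ∞` with `k` fixed. -/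
theorem WeightedGraph.tendsto_energy_sub {V : Type*} (G : WeightedGraph V) {u : ℕ → V → ℝ}
    {v : V → ℝ} (hv : ∀ x, Tendsto (fun n => u n x) atTop (𝓝 (v x)))
    (hu : ∀ ε : ℝ, 0 < ε → ∃ N, ∀ k ≥ N, ∀ l ≥ N, G.energy (u k - u l) ≤ ENNReal.ofReal ε) :
    Tendsto (fun n => G.energy (u n - v)) atTop (𝓝 0) := by
  refine ENNReal.tendsto_atTop_zero.2 fun ε hε => ?_
  -- Here `ε` may be `∞`, whereas the Cauchy hypothesis takes real bounds.
  have hε' : (min ε 1) ≠ ∞ := ((min_le_right _ _).trans_lt ENNReal.one_lt_top).ne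
  obtain ⟨N, hN⟩ := hu (min ε 1).toReal (ENNReal.toReal_pos (lt_min hε one_pos).ne' hε')
  rw [ENNReal.ofReal_toReal hε'] at hN
  refine ⟨N, fun k hk => G.energy_le_of_tendsto (u := fun l => u k - u l)
    (fun x => tendsto_const_nhds.sub (hv x)) ?_⟩
  filter_upwards [eventually_ge_atTop N] with l hl
  exact (hN k hk l hl).trans (min_le_left _ _)

theorem IsHilbertSpaceWith.of_forall_cauchy {W : Type*} [AddCommGroup W] [Module ℝ W]
    {B : W → W → ℝ} (symm : ∀ u v, B v u = B u v) (nonneg : ∀ u, 0 ≤ B u u)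
    (add_left : ∀ u v w, B (u + v) w = B u w + B v w) (smul_left : ∀ r u v, B (r • u) v = r * B u v)
    (definite : ∀ u, B u u = 0 → u = 0)
    (complete : ∀ u : ℕ → W,
      (∀ ε : ℝ, 0 < ε → ∃ N, ∀ k ≥ N, ∀ l ≥ N, B (u k - u l) (u k - u l) ≤ ε) →
      ∃ v, Tendsto (fun n => B (u n - v) (u n - v)) atTop (𝓝 0)) :
    IsHilbertSpaceWith W B := by
  let core : InnerProductSpace.Core ℝ W :=
    { inner := B
      conj_inner_symm := symm
      re_inner_nonneg := nonneg
      add_left := add_left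
      smul_left := fun u v r => smul_left r u v
      definite := definite }
  refine ⟨core, fun u v => rfl, ?_⟩
  let _ : NormedAddCommGroup W := core.toNormedAddCommGroup
  have hnorm : ∀ u : W, ‖u‖ = √(B u u) := fun u => rfl
  refine Metric.complete_of_cauchySeq_tendsto fun u hu => ?_
  obtain ⟨v, hv⟩ := complete u fun ε hε => by
    obtain ⟨N, hN⟩ := Metric.cauchySeq_iff.1 hu √ε (Real.sqrt_pos.2 hε)
    refine ⟨N, fun k hk l hl => ?_⟩
    have h1 := hN k hk l hl
    rw [dist_eq_norm, hnorm, Real.sqrt_lt_sqrt_iff (nonneg _)] at h1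
    exact h1.le
  refine ⟨v, tendsto_iff_norm_sub_tendsto_zero.2 ?_⟩
  simp only [hnorm]
  simpa using hv.sqrt

/-! ### Green function versus bounded point evaluations. -/

namespace DirichletForm

variable {V : Type*} {m : VertexMeasure V} {Q : DirichletForm m}

section Resolvent

variable {l : ℝ} (x : V)

theorem form_resolvent_delta (Q : DirichletForm m) (hl : 0 < l) (v : Q.domain) :
    Q.form (Q.resolventDomain hl (Ell2.delta m x)) v
      + l * inner ℝ (Q.resolvent l (Ell2.delta m x)) (v : Ell2 m) = v.1 x * m.mass x := by
  rw [Q.form_resolventDomain, Ell2.inner_delta]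

theorem form_resolvent_delta_self_le (Q : DirichletForm m) (hl : 0 < l) :
    Q.form (Q.resolventDomain hl (Ell2.delta m x)) (Q.resolventDomain hl (Ell2.delta m x))
      ≤ Q.resolvent l (Ell2.delta m x) x * m.mass x := by
  have h := Q.form_resolvent_delta x hl (Q.resolventDomain hl (Ell2.delta m x))
  change _ + l * inner ℝ (Q.resolvent l (Ell2.delta m x)) (Q.resolvent l (Ell2.delta m x))
    = Q.resolvent l (Ell2.delta m x) x * m.mass x at h
  rw [real_inner_self_eq_norm_sq] at h
  nlinarith [mul_nonneg hl.le (sq_nonneg ‖Q.resolvent l (Ell2.delta m x)‖)]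

/-- Cauchy–Schwarz for `E = Q + l⟨·,·⟩` and the kernel `g`: here `E(g, g) = g(x) m(x)` and `E(g, v)
= v(x) m(x)`. It is obtained from the discriminant of `s ↦ E(s g + v)`, and one factor `m(x)`
cancels. -/
theorem sq_apply_le_resolvent (Q : DirichletForm m) (hl : 0 < l) (v : Q.domain) :
    v.1 x ^ 2 * m.mass x
      ≤ Q.resolvent l (Ell2.delta m x) x * (Q.form v v + l * ‖(v : Ell2 m)‖ ^ 2) := by
  set g := Q.resolventDomain hl (Ell2.delta m x) with hg
  have hgg := Q.form_resolvent_delta x hl g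
  have hgv := Q.form_resolvent_delta x hl v
  rw [← hg] at hgg hgv
  change _ + l * inner ℝ (g : Ell2 m) (g : Ell2 m) = g.1 x * m.mass x at hgg
  change _ + l * inner ℝ (g : Ell2 m) (v : Ell2 m) = v.1 x * m.mass x at hgv
  change _ ≤ g.1 x * _
  have hd : discrim (g.1 x * m.mass x) (2 * (v.1 x * m.mass x))
      (Q.form v v + l * ‖(v : Ell2 m)‖ ^ 2) ≤ 0 := by
    refine discrim_le_zero fun s => ?_
    have h1 := Q.nonneg (s • g + v)
    have h2 := mul_nonneg hl.le (real_inner_self_nonneg (x := s • (g : Ell2 m) + v))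
    simp only [map_add, map_smul, LinearMap.add_apply, LinearMap.smul_apply, smul_eq_mul,
      Q.symm v g] at h1
    simp only [inner_add_left, inner_add_right, real_inner_smul_left, real_inner_smul_right,
      real_inner_comm (g : Ell2 m) (v : Ell2 m)] at h2
    rw [← hgg, ← hgv, ← real_inner_self_eq_norm_sq]
    rw [real_inner_comm (v : Ell2 m) (g : Ell2 m)] at h2 ⊢
    nlinarith
  have hm := m.mass_pos x
  rw [discrim] at hd
  refine le_of_mul_le_mul_right ?_ hm
  nlinarith

end Resolvent

/-- Evaluation at `x` is bounded on the form domain for the seminorm of `Q`. -/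
def IsBoundedAt (Q : DirichletForm m) (x : V) : Prop :=
  ∃ C : ℝ, 0 ≤ C ∧ ∀ v : Q.domain, |v.1 x| ≤ C * √(Q.form v v)

theorem isBoundedAt_of_green_lt_top {x : V} (h : Q.green x x < ∞) : Q.IsBoundedAt x := by
  refine ⟨√((Q.green x x).toReal / m.mass x), Real.sqrt_nonneg _, fun v => ?_⟩
  have hm := m.mass_pos x
  rw [← Real.sqrt_mul (by positivity)]
  refine Real.abs_le_sqrt ?_
  rw [div_mul_eq_mul_div, le_div_iff₀ hm]
  have hpos : ∀ n : ℕ, (0 : ℝ) < ((n : ℝ) + 1)⁻¹ := fun n => by positivity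
  have h1 := (ENNReal.tendsto_toReal h.ne).comp (Q.tendsto_resolvent_green x x)
  have h2 : Tendsto (fun n : ℕ => Q.form v v + ((n : ℝ) + 1)⁻¹ * ‖(v : Ell2 m)‖ ^ 2) atTop
      (𝓝 (Q.form v v)) := by
    simpa using ((tendsto_inv_atTop_zero.comp tendsto_natCast_add_one_atTop).mul_const
      (‖(v : Ell2 m)‖ ^ 2)).const_add (Q.form v v)
  refine ge_of_tendsto' (h1.mul h2) fun n => ?_
  rw [Function.comp_apply,
    ENNReal.toReal_ofReal (Q.resolvent_nonneg (hpos n) (Ell2.delta_nonneg x) x)]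
  exact Q.sq_apply_le_resolvent x (hpos n) v

/-- For the kernel `g`, `Q(g) ≤ g(x) m(x) ≤ C m(x) √Q(g)`, so `√Q(g) ≤ C m(x)` and `g(y) ≤ D C
m(x)`, uniformly in the resolvent parameter. -/
theorem IsBoundedAt.green_lt_top {x y : V} (hx : Q.IsBoundedAt x) (hy : Q.IsBoundedAt y) :
    Q.green x y < ∞ := by
  obtain ⟨C, hC0, hC⟩ := hx
  obtain ⟨D, hD0, hD⟩ := hy
  have hm := m.mass_pos x
  refine lt_of_le_of_lt (le_of_tendsto' (Q.tendsto_resolvent_green x y) fun n => ?_)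
    (ENNReal.ofReal_lt_top (r := D * (C * m.mass x)))
  have hpos : (0 : ℝ) < ((n : ℝ) + 1)⁻¹ := by positivity
  refine ENNReal.ofReal_le_ofReal ?_
  have h1 := Q.form_resolvent_delta_self_le x hpos
  set g := Q.resolventDomain hpos (Ell2.delta m x)
  change _ ≤ g.1 x * _ at h1
  change g.1 y ≤ _
  have h2 := (le_abs_self _).trans (hC g)
  refine (le_abs_self _).trans ((hD g).trans (mul_le_mul_of_nonneg_left ?_ hD0))
  have h3 := Real.sq_sqrt (Q.nonneg g)
  rcases (Real.sqrt_nonneg (Q.form g g)).eq_or_lt with h0 | h0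
  · rw [← h0]
    positivity
  · refine le_of_mul_le_mul_right ?_ h0
    nlinarith

/-! ### The transience–recurrence dichotomy and the extended Dirichlet space. -/

namespace IsAssociated

variable {G : WeightedGraph V}

theorem energy_lt_top (hQ : Q.IsAssociated G) (v : Q.domain) : G.energy v.1 < ∞ := hQ.subset_neumann v.2

theorem ofReal_form_self (hQ : Q.IsAssociated G) (v : Q.domain) : ENNReal.ofReal (Q.form v v) = G.energy v.1 := by
  rw [hQ.form_eq, G.ofReal_energyForm_self (hQ.energy_lt_top v)]

theorem exists_abs_sub_le (hQ : Q.IsAssociated G) (hG : G.Connected) (x y : V) :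
    ∃ C : ℝ, ∀ v : Q.domain, |v.1 x - v.1 y| ≤ C * √(Q.form v v) := by
  obtain ⟨C, hC⟩ := G.abs_sub_le_of_connected hG x y
  refine ⟨C, fun v => ?_⟩
  rw [hQ.form_eq]
  exact hC _ (hQ.energy_lt_top v)

theorem isBoundedAt (hQ : Q.IsAssociated G) (hG : G.Connected) {x : V} (hx : Q.IsBoundedAt x) (y : V) :
    Q.IsBoundedAt y := by
  obtain ⟨C, hC0, hC⟩ := hx
  obtain ⟨D, hD⟩ := hQ.exists_abs_sub_le hG x y
  refine ⟨C + |D|, by positivity, fun v => ?_⟩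
  have h1 := abs_sub_abs_le_abs_sub (v.1 y) (v.1 x)
  rw [abs_sub_comm] at h1
  have h2 := mul_le_mul_of_nonneg_right (le_abs_self D) (Real.sqrt_nonneg (Q.form v v))
  linarith [hC v, hD v]

/-- For the kernel `g`, `g(x) - g(y) ≤ C √Q(g) ≤ |C| √(g(x) m(x))`, and absorbing half of `g(x)`
gives `g(x) ≤ 2 g(y) + C² m(x)`. In the limit, `G(x, x) = ∞` forces `G(x, y) = ∞`. -/
theorem green_eq_top (hQ : Q.IsAssociated G) (hG : G.Connected) {x : V} (hx : ¬ Q.IsBoundedAt x) (y : V) :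
    Q.green x y = ∞ := by
  have hxx : Q.green x x = ∞ := by
    by_contra h
    exact hx (isBoundedAt_of_green_lt_top (lt_top_iff_ne_top.2 h))
  obtain ⟨C, hC⟩ := hQ.exists_abs_sub_le hG x y
  have hm := m.mass_pos x
  have key : Q.green x x ≤ 2 * Q.green x y + ENNReal.ofReal (C ^ 2 * m.mass x) := by
    refine le_of_tendsto_of_tendsto' (Q.tendsto_resolvent_green x x)
      ((ENNReal.Tendsto.const_mul (Q.tendsto_resolvent_green x y)
        (Or.inr ENNReal.ofNat_ne_top)).add_const _) fun n => ?_
    have hpos : (0 : ℝ) < ((n : ℝ) + 1)⁻¹ := by positivity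
    have hnn := Q.resolvent_nonneg hpos (Ell2.delta_nonneg x)
    rw [← ENNReal.ofReal_ofNat 2, ← ENNReal.ofReal_mul zero_le_two,
      ← ENNReal.ofReal_add (mul_nonneg zero_le_two (hnn y)) (by positivity)]
    refine ENNReal.ofReal_le_ofReal ?_
    have h1 := Q.form_resolvent_delta_self_le x hpos
    have h2 := hC (Q.resolventDomain hpos (Ell2.delta m x))
    have h0 := hnn x
    set g := Q.resolventDomain hpos (Ell2.delta m x)
    change _ ≤ g.1 x * _ at h1
    change 0 ≤ g.1 x at h0
    change g.1 x ≤ 2 * g.1 y + _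
    have h3 : |C| * √(Q.form g g) ≤ |C| * (√(g.1 x) * √(m.mass x)) := by
      rw [← Real.sqrt_mul h0]
      exact mul_le_mul_of_nonneg_left (Real.sqrt_le_sqrt h1) (abs_nonneg _)
    have h4 := mul_le_mul_of_nonneg_right (le_abs_self C) (Real.sqrt_nonneg (Q.form g g))
    have h5 := Real.sq_sqrt h0
    have h6 := Real.sq_sqrt hm.le
    have h7 := le_abs_self (g.1 x - g.1 y)
    have h8 : C ^ 2 * m.mass x = (|C| * √(m.mass x)) ^ 2 := by rw [mul_pow, sq_abs, h6]
    nlinarith [sq_nonneg (√(g.1 x) - |C| * √(m.mass x))]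
  rw [hxx, top_le_iff] at key
  by_contra h
  exact ENNReal.add_ne_top.2 ⟨ENNReal.mul_ne_top (by simp) h, ENNReal.ofReal_ne_top⟩ key

theorem isRecurrent_iff (hQ : Q.IsAssociated G) (hG : G.Connected) (x : V) : Q.IsRecurrent ↔ ¬ Q.IsBoundedAt x := by
  refine ⟨fun h hx => (hx.green_lt_top hx).ne (h x x), fun h y z => ?_⟩
  exact hQ.green_eq_top hG (fun hy => h (hQ.isBoundedAt hG hy x)) z

theorem isTransient_iff (hQ : Q.IsAssociated G) (hG : G.Connected) (x : V) : Q.IsTransient ↔ Q.IsBoundedAt x :=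
  ⟨fun h => isBoundedAt_of_green_lt_top (h x x),
    fun h y z => (hQ.isBoundedAt hG h y).green_lt_top (hQ.isBoundedAt hG h z)⟩

theorem exists_tendsto_one (hQ : Q.IsAssociated G) (hG : G.Connected) {x : V} (hx : ¬ Q.IsBoundedAt x) :
    ∃ u : ℕ → Q.domain, (∀ y, Tendsto (fun n => (u n).1 y) atTop (𝓝 1)) ∧
      Tendsto (fun n => Q.form (u n) (u n)) atTop (𝓝 0) := by
  -- Failure of the bound with constant `n + 1`; dividing `v` by `v(x)` then leaves energy root at
  -- most `1/(n + 1)`.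
  have h : ∀ n : ℕ, ∃ v : Q.domain, ((n : ℝ) + 1) * √(Q.form v v) < |v.1 x| := fun n => by
    by_contra! hn
    exact hx ⟨n + 1, by positivity, hn⟩
  choose v hv using h
  have hvx : ∀ n, 0 < |(v n).1 x| := fun n => lt_of_le_of_lt (by positivity) (hv n)
  set u : ℕ → Q.domain := fun n => ((v n).1 x)⁻¹ • v n with hu
  have hux : ∀ n, (u n).1 x = 1 := fun n => inv_mul_cancel₀ (abs_pos.1 (hvx n))
  have hform : ∀ n, √(Q.form (u n) (u n)) ≤ ((n : ℝ) + 1)⁻¹ := fun n => by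
    simp only [hu, map_smul, LinearMap.smul_apply, smul_eq_mul]
    rw [← mul_assoc, Real.sqrt_mul (mul_self_nonneg _), Real.sqrt_mul_self_eq_abs, abs_inv,
      inv_mul_le_iff₀ (hvx n), mul_comm, le_inv_mul_iff₀ (by positivity)]
    exact (hv n).le
  have hlim : Tendsto (fun n => √(Q.form (u n) (u n))) atTop (𝓝 0) :=
    squeeze_zero (fun n => Real.sqrt_nonneg _) hform
      (tendsto_inv_atTop_zero.comp tendsto_natCast_add_one_atTop)
  refine ⟨u, fun y => ?_, ?_⟩
  · obtain ⟨C, hC⟩ := hQ.exists_abs_sub_le hG y x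
    refine tendsto_iff_norm_sub_tendsto_zero.2 (squeeze_zero (fun n => norm_nonneg _)
      (fun n => ?_) (by simpa using hlim.const_mul C))
    have := hC (u n)
    rwa [hux] at this
  · have := hlim.pow 2
    simpa only [Real.sq_sqrt (Q.nonneg _), zero_pow two_ne_zero, ne_eq, OfNat.ofNat_ne_zero,
      not_false_eq_true] using this

theorem isCauchy_of_tendsto_energy_sub (hQ : Q.IsAssociated G) {w : ℕ → Q.domain} {u : V → ℝ}
    (h : Tendsto (fun n => G.energy ((w n).1 - u)) atTop (𝓝 0)) : Q.IsCauchy w := by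
  intro ε hε
  obtain ⟨N, hN⟩ := ENNReal.tendsto_atTop_zero.1 h (ENNReal.ofReal (ε ^ 2 / 8))
    (ENNReal.ofReal_pos.2 (by positivity))
  refine ⟨N, fun k hk l hl => ?_⟩
  rw [Real.sqrt_lt' hε]
  have h1 : G.energy (w k - w l).1 ≤ ENNReal.ofReal (ε ^ 2 / 2) := by
    have h2 := G.energy_add_le ((w k).1 - u) (u - (w l).1)
    rw [G.energy_sub_comm u] at h2
    have h3 : (w k - w l).1.1 = (w k).1.1 - u + (u - (w l).1.1) := (sub_add_sub_cancel _ _ _).symm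
    rw [h3]
    refine h2.trans ((add_le_add (mul_le_mul_right (hN k hk) 2)
      (mul_le_mul_right (hN l hl) 2)).trans_eq ?_)
    rw [← ENNReal.ofReal_ofNat 2, ← ENNReal.ofReal_mul zero_le_two,
      ← ENNReal.ofReal_add (by positivity) (by positivity)]
    congr 1
    ring
  rw [← hQ.ofReal_form_self, ENNReal.ofReal_le_ofReal_iff (by positivity)] at h1
  nlinarith [sq_pos_of_pos hε]

theorem exists_tendsto_energy_sub (hQ : Q.IsAssociated G) {u : V → ℝ} (hu : u ∈ Q.extendedSpace) :
    ∃ w : ℕ → Q.domain, (∀ x, Tendsto (fun n => (w n).1 x) atTop (𝓝 (u x))) ∧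
      Tendsto (fun n => G.energy ((w n).1 - u)) atTop (𝓝 0) := by
  obtain ⟨w, hw, hwu⟩ := hu
  refine ⟨w, hwu, G.tendsto_energy_sub hwu fun ε hε => ?_⟩
  obtain ⟨N, hN⟩ := hw √ε (Real.sqrt_pos.2 hε)
  refine ⟨N, fun k hk l hl => ?_⟩
  have h1 := hQ.ofReal_form_self (w k - w l)
  change _ = G.energy ((w k).1 - (w l).1) at h1
  rw [← h1]
  exact ENNReal.ofReal_le_ofReal ((Real.sqrt_lt_sqrt_iff (Q.nonneg _)).1 (hN k hk l hl)).le

theorem energy_lt_top_of_mem_extendedSpace (hQ : Q.IsAssociated G) {u : V → ℝ} (hu : u ∈ Q.extendedSpace) :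
    G.energy u < ∞ := by
  obtain ⟨w, -, hw⟩ := hQ.exists_tendsto_energy_sub hu
  obtain ⟨n, hn⟩ := (hw.eventually (gt_mem_nhds zero_lt_one)).exists
  have h1 := G.energy_add_le (w n).1 (u - (w n).1)
  rw [add_sub_cancel, G.energy_sub_comm u] at h1
  exact h1.trans_lt (ENNReal.add_lt_top.2 ⟨ENNReal.mul_lt_top (by simp) (hQ.energy_lt_top _),
    ENNReal.mul_lt_top (by simp) (hn.trans ENNReal.one_lt_top)⟩)

theorem exists_abs_le_of_isBoundedAt (hQ : Q.IsAssociated G) {x : V} (hx : Q.IsBoundedAt x) :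
    ∃ C : ℝ, ∀ u ∈ Q.extendedSpace, |u x| ≤ C * √(G.energyForm u u) := by
  obtain ⟨C, hC0, hC⟩ := hx
  -- The factor `2` is the loss in `energy_add_le` when an approximant `w n` is split as `u + (w n -
  -- u)`.
  refine ⟨√(C ^ 2 * 2), fun u hu => ?_⟩
  obtain ⟨w, hwu, hw⟩ := hQ.exists_tendsto_energy_sub hu
  rw [← Real.sqrt_mul (by positivity)]
  refine Real.abs_le_sqrt ?_
  have h0 := G.energyForm_self_nonneg u
  rw [← ENNReal.ofReal_le_ofReal_iff (by positivity), ENNReal.ofReal_mul (by positivity),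
    ENNReal.ofReal_mul (by positivity),
    G.ofReal_energyForm_self (hQ.energy_lt_top_of_mem_extendedSpace hu), mul_assoc]
  have h1 : Tendsto (fun n => ENNReal.ofReal (C ^ 2) * (2 * G.energy u + 2 * G.energy ((w n).1 - u)))
      atTop (𝓝 (ENNReal.ofReal (C ^ 2) * (ENNReal.ofReal 2 * G.energy u))) := by
    refine ENNReal.Tendsto.const_mul ?_ (Or.inr ENNReal.ofReal_ne_top)
    have := (ENNReal.Tendsto.const_mul (a := 2) hw (Or.inr ENNReal.ofNat_ne_top)).const_add
      (2 * G.energy u)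
    simpa using this
  refine le_of_tendsto_of_tendsto' (ENNReal.tendsto_ofReal ((hwu x).pow 2)) h1 fun n => ?_
  have h2 := G.energy_add_le u ((w n).1 - u)
  rw [add_sub_cancel] at h2
  refine le_trans ?_ (mul_le_mul_right h2 _)
  rw [← hQ.ofReal_form_self, ← ENNReal.ofReal_mul (by positivity)]
  refine ENNReal.ofReal_le_ofReal ?_
  rw [← Real.sq_sqrt (Q.nonneg (w n)), ← mul_pow, ← sq_abs]
  exact pow_le_pow_left₀ (abs_nonneg _) (hC _) 2

/-- Lower semicontinuity gives `1` zero energy, so the energy of `u n - 1` is at most twice that of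
`u n`; hence `u` itself is an admissible approximating sequence. -/
theorem one_mem_extendedSpace (hQ : Q.IsAssociated G) {u : ℕ → Q.domain}
    (hu : ∀ x, Tendsto (fun n => (u n).1 x) atTop (𝓝 1))
    (hQu : Tendsto (fun n => Q.form (u n) (u n)) atTop (𝓝 0)) :
    (1 : V → ℝ) ∈ Q.extendedSpace ∧ G.energyForm 1 1 = 0 := by
  have h1 : Tendsto (fun n => G.energy (u n).1) atTop (𝓝 0) := by
    simpa only [hQ.ofReal_form_self, ENNReal.ofReal_zero] using ENNReal.tendsto_ofReal hQu
  have h2 : G.energy 1 = 0 := by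
    refine le_antisymm (ENNReal.le_of_forall_pos_le_add fun ε hε _ => ?_) zero_le
    rw [zero_add]
    exact G.energy_le_of_tendsto hu (h1.eventually (ge_mem_nhds (ENNReal.coe_pos.2 hε)))
  have h3 : Tendsto (fun n => G.energy ((u n).1 - 1)) atTop (𝓝 0) := by
    refine tendsto_of_tendsto_of_tendsto_of_le_of_le tendsto_const_nhds
      (h := fun n => 2 * G.energy (u n).1) ?_ (fun n => zero_le) fun n => ?_
    · simpa using ENNReal.Tendsto.const_mul (a := 2) h1 (Or.inr ENNReal.ofNat_ne_top)
    · have := G.energy_add_le (u n).1 ((-1 : ℝ) • 1)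
      rw [G.energy_smul, h2, mul_zero, mul_zero, add_zero, neg_one_smul, ← sub_eq_add_neg] at this
      exact this
  refine ⟨⟨u, hQ.isCauchy_of_tendsto_energy_sub h3, hu⟩, ?_⟩
  have h4 := G.ofReal_energyForm_self (h2.trans_lt ENNReal.zero_lt_top)
  rw [h2, ENNReal.ofReal_eq_zero] at h4
  exact le_antisymm h4 (G.energyForm_self_nonneg 1)

/-- Bounded evaluations make a Cauchy sequence converge pointwise, and then in energy, to some `v`.
Membership of `v` in the extended space needs approximants from `D(Q)`: choose `w n` energy-close to
`u n`, so that `w` also tends to `v` pointwise and in energy. -/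
theorem isHilbertSpaceWith (hQ : Q.IsAssociated G) (hb : ∀ x, Q.IsBoundedAt x) :
    IsHilbertSpaceWith Q.extendedSpace fun u v => G.energyForm u v := by
  have hfin : ∀ u : Q.extendedSpace, G.energy u < ∞ := fun u =>
    hQ.energy_lt_top_of_mem_extendedSpace u.2
  choose C hC using fun x => hQ.exists_abs_le_of_isBoundedAt (hb x)
  have hen : ∀ u ∈ Q.extendedSpace, G.energy u = ENNReal.ofReal (G.energyForm u u) := fun u hu =>
    (G.ofReal_energyForm_self (hfin ⟨u, hu⟩)).symm
  refine .of_forall_cauchy (fun u v => G.energyForm_comm _ _) (fun u => G.energyForm_self_nonneg _)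
    (fun u v w => G.energyForm_add_left (hfin u) (hfin v) (hfin w))
    (fun r u v => G.energyForm_smul_left r (hfin u) (hfin v)) (fun u hu => ?_) fun u hu => ?_
  · refine Subtype.ext (funext fun x => ?_)
    have h1 := hC x u u.2
    rw [hu, Real.sqrt_zero, mul_zero] at h1
    exact abs_nonpos_iff.1 h1
  have hpt : ∀ x, ∃ a, Tendsto (fun n => (u n).1 x) atTop (𝓝 a) := fun x => by
    refine cauchySeq_tendsto_of_complete (Metric.cauchySeq_iff.2 fun ε hε => ?_)
    obtain ⟨N, hN⟩ := hu ((ε / (|C x| + 1)) ^ 2) (by positivity)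
    refine ⟨N, fun k hk l hl => ?_⟩
    have h1 := Real.sqrt_le_iff.2 ⟨by positivity, hN k hk l hl⟩
    rw [le_div_iff₀ (by positivity)] at h1
    have h2 := hC x (u k - u l : Q.extendedSpace) (u k - u l).2
    have h3 := mul_le_mul_of_nonneg_right (le_abs_self (C x))
      (Real.sqrt_nonneg (G.energyForm (u k - u l : Q.extendedSpace) (u k - u l : Q.extendedSpace)))
    rw [Real.dist_eq]
    refine lt_of_le_of_lt h2 ?_
    rcases (Real.sqrt_nonneg (G.energyForm (u k - u l : Q.extendedSpace)
      (u k - u l : Q.extendedSpace))).eq_or_lt with h0 | h0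
    · rw [← h0, mul_zero]
      exact hε
    · linarith
  choose v hv using hpt
  have huv : Tendsto (fun n => G.energy ((u n).1 - v)) atTop (𝓝 0) := by
    refine G.tendsto_energy_sub hv fun ε hε => ?_
    obtain ⟨N, hN⟩ := hu ε hε
    exact ⟨N, fun k hk l hl => (hen _ (u k - u l).2).trans_le
      (ENNReal.ofReal_le_ofReal (hN k hk l hl))⟩
  have hmem : ∀ z : Q.domain, (z.1.1 : V → ℝ) ∈ Q.extendedSpace := fun z =>
    ⟨fun _ => z, fun ε hε => ⟨0, fun k _ l _ => by simpa using hε⟩, fun x => tendsto_const_nhds⟩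
  have happ : ∀ n : ℕ, ∃ w : Q.domain, G.energy (w.1.1 - (u n).1)
      ≤ ENNReal.ofReal ((n : ℝ) + 1)⁻¹ := fun n => by
    obtain ⟨w, -, hw⟩ := hQ.exists_tendsto_energy_sub (u n).2
    have hpos : (0 : ℝ) < ((n : ℝ) + 1)⁻¹ := by positivity
    obtain ⟨k, hk⟩ := (hw.eventually (ge_mem_nhds (ENNReal.ofReal_pos.2 hpos))).exists
    exact ⟨w k, hk⟩
  choose w hw using happ
  have hlim : Tendsto (fun n => G.energy ((w n).1.1 - (u n).1)) atTop (𝓝 0) := by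
    refine tendsto_of_tendsto_of_tendsto_of_le_of_le tendsto_const_nhds ?_ (fun n => zero_le) hw
    simpa [Function.comp_def] using ENNReal.tendsto_ofReal
      (tendsto_inv_atTop_zero.comp tendsto_natCast_add_one_atTop)
  have hwv : ∀ x, Tendsto (fun n => (w n).1 x) atTop (𝓝 (v x)) := fun x => by
    have h1 : Tendsto (fun n => (w n).1 x - (u n).1 x) atTop (𝓝 0) := by
      have h2 := ((ENNReal.tendsto_toReal ENNReal.zero_ne_top).comp hlim).sqrt.const_mul (C x)
      rw [ENNReal.toReal_zero, Real.sqrt_zero, mul_zero] at h2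
      refine squeeze_zero_norm (fun n => ?_) h2
      have hs := sub_mem (hmem (w n)) (u n).2
      rw [Function.comp_apply, hen _ hs, ENNReal.toReal_ofReal (G.energyForm_self_nonneg _)]
      exact hC x _ hs
    simpa using h1.add (hv x)
  have hwe : Tendsto (fun n => G.energy ((w n).1 - v)) atTop (𝓝 0) := by
    refine tendsto_of_tendsto_of_tendsto_of_le_of_le tendsto_const_nhds
      (h := fun n => 2 * G.energy ((w n).1 - (u n).1) + 2 * G.energy ((u n).1 - v)) ?_
      (fun n => zero_le) fun n => ?_
    · simpa using (ENNReal.Tendsto.const_mul (a := 2) hlim (Or.inr ENNReal.ofNat_ne_top)).add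
        (ENNReal.Tendsto.const_mul (a := 2) huv (Or.inr ENNReal.ofNat_ne_top))
    · refine le_of_eq_of_le ?_ (G.energy_add_le _ _)
      rw [sub_add_sub_cancel]
  have hvmem : v ∈ Q.extendedSpace := ⟨w, hQ.isCauchy_of_tendsto_energy_sub hwe, hwv⟩
  refine ⟨⟨v, hvmem⟩, ?_⟩
  refine ((ENNReal.tendsto_toReal ENNReal.zero_ne_top).comp huv).congr fun n => ?_
  rw [Function.comp_apply, hen _ (sub_mem (u n).2 hvmem),
    ENNReal.toReal_ofReal (G.energyForm_self_nonneg _)]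
  rfl

end IsAssociated

end DirichletForm

end

theorem mainTheorem10 {V : Type*} [Countable V] [Infinite V] (m : VertexMeasure V)
    (G : WeightedGraph V) (hG : G.Connected) (Q : DirichletForm m) (hQ : Q.IsAssociated G) :
    List.TFAE [
      Q.IsRecurrent,
      ∃ u : ℕ → Q.domain, (∀ x, Tendsto (fun n => (u n).1 x) atTop (𝓝 1)) ∧
        Tendsto (fun n => Q.form (u n) (u n)) atTop (𝓝 0),
      (1 : V → ℝ) ∈ Q.extendedSpace ∧ G.energyForm 1 1 = 0] ∧
    List.TFAE [
      Q.IsTransient,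
      ∀ u ∈ Q.extendedSpace, G.energyForm u u = 0 → u = 0,
      IsHilbertSpaceWith Q.extendedSpace fun u v => G.energyForm u v] := by
  obtain ⟨o⟩ : Nonempty V := inferInstance
  rw [hQ.isRecurrent_iff hG o, hQ.isTransient_iff hG o]
  have h0 : ∀ u ∈ Q.extendedSpace, G.energyForm u u = 0 → Q.IsBoundedAt o → u o = 0 := by
    intro u hu hu0 hb
    obtain ⟨C, hC⟩ := hQ.exists_abs_le_of_isBoundedAt hb
    have h1 := hC u hu
    rw [hu0, Real.sqrt_zero, mul_zero] at h1
    exact abs_nonpos_iff.1 h1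
  constructor
  · tfae_have 1 → 2 := hQ.exists_tendsto_one hG
    tfae_have 2 → 3 := fun ⟨u, hu, hQu⟩ => hQ.one_mem_extendedSpace hu hQu
    tfae_have 3 → 1 := fun ⟨h1, h2⟩ hb => one_ne_zero (h0 1 h1 h2 hb)
    tfae_finish
  · tfae_have 1 → 3 := fun hb => hQ.isHilbertSpaceWith (hQ.isBoundedAt hG hb)
    tfae_have 3 → 2 := by
      rintro ⟨core, hcore, -⟩ u hu hu0
      exact congrArg Subtype.val (core.definite ⟨u, hu⟩ ((hcore _ _).trans hu0))
    -- By contraposition: unbounded evaluation makes the constant `1` a nonzero null element of the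
    -- extended space.
    tfae_have 2 → 1 := by
      intro h
      by_contra hb
      obtain ⟨u, hu, hQu⟩ := hQ.exists_tendsto_one hG hb
      obtain ⟨h1, h2⟩ := hQ.one_mem_extendedSpace hu hQu
      exact one_ne_zero (congrFun (h 1 h1 h2) o)
    tfae_finish
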